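/- Let $d\ge 2$ and let $(\mathcal M,g)$ be a compact connected smooth $d$-dimensional Riemannian manifold without boundary, with geodesic distance $d_g$. Let $L,B>0$, and let $\mathcal F$ be a nonempty class of functions $f:\mathcal M\to\mathbb R$ that are $L$-Lipschitz with respect to $d_g$ and satisfy $|f|\le B$. For a Borel probability measure $\mu$ on $\mathcal M$ and $n\ge 1$ let $$\mathrm{Rad}_n(\mathcal F)=\mathbb E\,\sup_{f\in\mathcal F}\frac1n\sum_{i=1}^n\sigma_i f(x_i),$$ where $x_1,\dots,x_n\sim\mu$ are i.i.d. and $\sigma_1,\dots,\sigma_n$ are independent uniform signs, independent of the $x_i$. Let $N(\mathcal F,\epsilon,\|\cdot\|_\infty)$ be the least number of sup-norm balls of radius $\epsilon$, centred at arbitrary functions, that cover $\mathcal F$. (i) For every $\mu$ and every $n\ge1$, all covering numbers at scales $\epsilon>0$ are finite, the supremum above is integrable as a function of the sample, the entropy integrals below exist, and $$\mathrm{Rad}_n(\mathcal F)\le\inf_{\alpha>0}\Big\{4\alpha+\frac{12}{\sqrt n}\int_\alpha^B\sqrt{\log N(\mathcal F,\epsilon,\|\cdot\|_\infty)}\,d\epsilon\Big\}.$$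 (ii) Put $\psi(\kappa,L)=\sqrt{|\kappa|}/L$. There are constants $C$ and $n_0$, depending only on $(\mathcal M,g)$, $L$ and $B$, such that whenever all sectional curvatures of $\mathcal M$ lie in $[\kappa_{\min},\kappa_{\max}]$, one has for all $\mu$, all $\mathcal F$ as above and all $n\ge n_0$ $$\mathrm{Rad}_n(\mathcal F)\le C\,\frac{\sqrt{d\log(L\sqrt n)+\psi(\kappa_{\max},L)}}{n^{1/d}}.$$ If moreover $d\ge3$, the quantity in braces in (i), evaluated at $\alpha=n^{-1/d}$, is itself at most this right-hand side. -/

import Mathlib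

open Set MeasureTheory Metric
open scoped Manifold ContDiff Bundle UniformConvergence NNReal

noncomputable section

section Curvature

variable {d : ℕ} {M : Type*} [TopologicalSpace M] [ChartedSpace (EuclideanSpace ℝ (Fin d)) M]
  [Bundle.RiemannianBundle (fun x : M => TangentSpace (𝓡 d) x)]

/-- The `i`-th coordinate vector field of the preferred chart at `p`, at the point of `M` whose
coordinates in that chart are `y`. -/
def coordVector (p : M) (y : EuclideanSpace ℝ (Fin d)) (i : Fin d) :
    TangentSpace (𝓡 d) ((extChartAt (𝓡 d) p).symm y) :=
  mfderiv 𝓘(ℝ, EuclideanSpace ℝ (Fin d)) (𝓡 d) (extChartAt (𝓡 d) p).symm y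
    (EuclideanSpace.single i (1 : ℝ) : EuclideanSpace ℝ (Fin d))

/-- The matrix `g_{ij}` of the Riemannian metric in the preferred chart at `p`, as a function of
the coordinates `y`. -/
def metricMatrix (p : M) (y : EuclideanSpace ℝ (Fin d)) : Matrix (Fin d) (Fin d) ℝ :=
  Matrix.of fun i j => inner ℝ (coordVector p y i) (coordVector p y j)

/-- The `i`-th partial derivative of a function on `ℝ^d`. -/
def partialDeriv (i : Fin d) (h : EuclideanSpace ℝ (Fin d) → ℝ) (y : EuclideanSpace ℝ (Fin d)) :
    ℝ :=
  fderiv ℝ h y (EuclideanSpace.single i (1 : ℝ))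

/-- The Christoffel symbol `Γ^k_{ij}` of the Levi-Civita connection in the preferred chart at
`p`. -/
def christoffel (p : M) (k i j : Fin d) (y : EuclideanSpace ℝ (Fin d)) : ℝ :=
  (1 / 2) * ∑ l, (metricMatrix p y)⁻¹ k l *
    (partialDeriv i (fun z => metricMatrix p z j l) y
      + partialDeriv j (fun z => metricMatrix p z i l) y
      - partialDeriv l (fun z => metricMatrix p z i j) y)

/-- The component `R^l_{ijk}` of the Riemann curvature tensor in the preferred chart at `p`:
`R(∂_i, ∂_j) ∂_k = ∑ l, R^l_{ijk} ∂_l`, where `R(X, Y) = ∇_X ∇_Y - ∇_Y ∇_X - ∇_{[X, Y]}`. -/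
def riemannTensor (p : M) (l i j k : Fin d) (y : EuclideanSpace ℝ (Fin d)) : ℝ :=
  partialDeriv i (christoffel p l j k) y - partialDeriv j (christoffel p l i k) y
    + ∑ m, (christoffel p m j k y * christoffel p l i m y
      - christoffel p m i k y * christoffel p l j m y)

/-- The coordinates of a tangent vector at `p` in the preferred chart at `p`. -/
def tangentCoord (p : M) (u : TangentSpace (𝓡 d) p) : EuclideanSpace ℝ (Fin d) :=
  mfderiv (𝓡 d) 𝓘(ℝ, EuclideanSpace ℝ (Fin d)) (extChartAt (𝓡 d) p) p u

/-- The sectional curvature `⟨R(u, v) v, u⟩ / (|u|² |v|² - ⟨u, v⟩²)` of the plane spanned by two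
linearly independent tangent vectors `u`, `v` at `p`. -/
def sectionalCurvature (p : M) (u v : TangentSpace (𝓡 d) p) : ℝ :=
  (∑ i, ∑ j, ∑ k, ∑ l, ∑ m,
      riemannTensor p l i j k (extChartAt (𝓡 d) p p) * tangentCoord p u i * tangentCoord p v j
        * tangentCoord p v k * metricMatrix p (extChartAt (𝓡 d) p p) l m * tangentCoord p u m)
    / (‖u‖ ^ 2 * ‖v‖ ^ 2 - (inner ℝ u v) ^ 2)

/-- All sectional curvatures of `M` lie in `[κmin, κmax]`. -/
def SectionalCurvatureBounds (d : ℕ) (M : Type*) [TopologicalSpace M]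
    [ChartedSpace (EuclideanSpace ℝ (Fin d)) M]
    [Bundle.RiemannianBundle (fun x : M => TangentSpace (𝓡 d) x)] (κmin κmax : ℝ) : Prop :=
  ∀ (p : M) (u v : TangentSpace (𝓡 d) p), LinearIndependent ℝ ![u, v] →
    κmin ≤ sectionalCurvature p u v ∧ sectionalCurvature p u v ≤ κmax

end Curvature

section Learning

variable {X : Type*}

/-- The class of all `L`-Lipschitz functions `f : X → ℝ` with `|f| ≤ B`. -/
def lipschitzClass (X : Type*) [MetricSpace X] (L B : ℝ) : Set (X → ℝ) :=
  {f | (∀ x y, |f x - f y| ≤ L * dist x y) ∧ ∀ x, |f x| ≤ B}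

/-- The empirical Rademacher complexity of `F` on the sample `x`, that is
`E_σ sup_{f ∈ F} (1/n) ∑ i, σ_i f(x_i)` with independent uniform signs `σ_i = ±1`. -/
def empiricalRademacher (F : Set (X → ℝ)) {n : ℕ} (x : Fin n → X) : ℝ :=
  (1 / 2 ^ n) * ∑ σ : Fin n → ℤˣ, ⨆ f : F, (1 / (n : ℝ)) * ∑ i, ((σ i : ℤ) : ℝ) * f.1 (x i)

/-- The Rademacher complexity `Rad_n(F)`: the expectation of the empirical Rademacher complexity
of an i.i.d. sample of size `n` from `μ`. -/
def rademacher [MeasurableSpace X] (μ : Measure X) (n : ℕ) (F : Set (X → ℝ)) : ℝ :=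
  ∫ x : Fin n → X, empiricalRademacher F x ∂(Measure.pi fun _ => μ)

/-- The covering number `N(F, ε, ‖·‖_∞)`: the least number of sup-norm balls of radius `ε`, with
arbitrary functions as centres, that cover `F` (`⊤` if there is no finite cover). -/
def supCoveringNumber (F : Set (X → ℝ)) (ε : ℝ) : ℕ∞ :=
  externalCoveringNumber ε.toNNReal (UniformFun.ofFun '' F : Set (X →ᵤ ℝ))

/-- The entropy integrand `√(log N(F, ε, ‖·‖_∞))`. -/
def sqrtEntropy (F : Set (X → ℝ)) (ε : ℝ) : ℝ :=
  √(Real.log ((supCoveringNumber F ε).toNat : ℝ))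

/-- The quantity `4 α + (12 / √n) ∫_α^B √(log N(F, ε, ‖·‖_∞)) dε`. -/
def dudleyBound (F : Set (X → ℝ)) (B : ℝ) (n : ℕ) (α : ℝ) : ℝ :=
  4 * α + 12 / √(n : ℝ) * ∫ ε in α..B, sqrtEntropy F ε

/-- The curvature penalty `ψ(κ, L) = √|κ| / L`. -/
def curvaturePenalty (κ L : ℝ) : ℝ := √|κ| / L

/-- The rate `√(d log (L √n) + ψ(κ, L)) / n^{1/d}`. -/
def curvatureRate (d : ℕ) (κ L : ℝ) (n : ℕ) : ℝ :=
  √((d : ℝ) * Real.log (L * √(n : ℝ)) + curvaturePenalty κ L) / (n : ℝ) ^ (1 / (d : ℝ))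

end Learning

end

/-! Compactness reduces geometry to finitely many pieces, each with coordinates in the unit cube
whose inverse is Lipschitz for the geodesic distance (`exists_piecewise_coordinates`). The constant
`C` absorbs the number of pieces and the Lipschitz constant. Since `ψ ≥ 0`, the target rate
dominates `√(log n) / n^{1/d}` for large `n` (`sqrt_log_div_le_curvatureRate`), so this simpler rate
suffices.

Part (i) is chaining over the scales `B / 2^j`, with Massart's lemma at each link. It holds for
every fixed sample, hence after integration.

For `d ≥ 3`, functions constant on small coordinate cells give entropy `O(ε^{-d} log (1/ε))`
(`log_supCoveringNumber_le`). As `d / 2 > 1`, the integral of `ε^{-d/2}` is dominated by its lower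
end, and `α = n^{-1/d}` balances the two terms of the Dudley bound.

For `d = 2` the integrand is `1/ε` up to logarithms: this entropy bound gives `(log n)^{3/2} / √n`,
and even `ε^{-2}` would give `log n / √n`. Instead, a function on a planar grid is recovered at a
node by pairing its discrete gradient with a unit flow that leaves the node and spreads out. On a
grid of mesh `1 / N` the gradient has bounded `ℓ²` norm, and the flow has energy `O(log N)`. The
class is thus within `O(1 / N)` of a bounded set of linear functionals of a feature map, and
Cauchy–Schwarz with orthogonality of the signs gives `√(log n / n)` for `N` of order `√n`
(`empiricalRademacher_le_planar`). -/

noncomputable section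

/-! ### Coordinates with Lipschitz inverse -/

section Chart
open Filter Manifold
open scoped Topology ENNReal

attribute [local instance] normedAddCommGroupTangentSpaceVectorSpace
attribute [local instance] normedSpaceTangentSpaceVectorSpace

theorem eventually_enorm_mfderivWithin_symm_extChartAt_apply_le {E : Type*}
    [NormedAddCommGroup E] [NormedSpace ℝ E] {H : Type*} [TopologicalSpace H]
    (I : ModelWithCorners ℝ E H) {M : Type*} [TopologicalSpace M] [ChartedSpace H M]
    [Bundle.RiemannianBundle (fun x : M => TangentSpace I x)] [IsManifold I 1 M]
    [IsContinuousRiemannianBundle E (fun x : M => TangentSpace I x)] (x : M) :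
    ∃ C > (0 : ℝ≥0), ∀ᶠ y in 𝓝[range I] (extChartAt I x x), ∀ v : E,
      ‖mfderiv[range I] (extChartAt I x).symm y v‖ₑ ≤ C * ‖v‖ₑ := by
  rcases eventually_enorm_mfderivWithin_symm_extChartAt_lt I x with ⟨C, C_pos, hC⟩
  refine ⟨C, C_pos, ?_⟩
  filter_upwards [hC] with y hy v
  have := @ContinuousLinearMap.le_opENorm ℝ ℝ (TangentSpace 𝓘(ℝ, E) y)
    (TangentSpace I ((extChartAt I x).symm y)) inferInstance inferInstance inferInstance
    inferInstance inferInstance inferInstance (RingHom.id ℝ) inferInstance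
    (mfderiv[range I] (extChartAt I x).symm y) v
  refine this.trans ?_
  exact mul_le_mul_left hy.le _

/-- The inverse of a chart is locally Lipschitz for the Riemannian distance. -/
theorem exists_nhds_riemannianEDist_le_edist_extChartAt {E : Type*} [NormedAddCommGroup E]
    [NormedSpace ℝ E] {H : Type*} [TopologicalSpace H] (I : ModelWithCorners ℝ E H)
    {M : Type*} [TopologicalSpace M] [ChartedSpace H M]
    [Bundle.RiemannianBundle (fun x : M => TangentSpace I x)] [IsManifold I 1 M]
    [IsContinuousRiemannianBundle E (fun x : M => TangentSpace I x)] (x : M) :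
    ∃ C > (0 : ℝ≥0), ∃ U ∈ 𝓝 x, ∀ y ∈ U, ∀ z ∈ U,
      riemannianEDist I y z ≤ C * edist (extChartAt I x y) (extChartAt I x z) := by
  rcases eventually_enorm_mfderivWithin_symm_extChartAt_apply_le I x with ⟨C, C_pos, hC⟩
  obtain ⟨r, r_pos, hr⟩ : ∃ r > 0,
      ball (extChartAt I x x) r ∩ range I ⊆ (extChartAt I x).target ∩
        {y | ∀ v : E, ‖mfderiv[range I] (extChartAt I x).symm y v‖ₑ ≤ C * ‖v‖ₑ} :=
    mem_nhdsWithin_iff.1 (inter_mem (extChartAt_target_mem_nhdsWithin x) hC)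
  have A : (extChartAt I x) ⁻¹' (ball (extChartAt I x x) r ∩ range I) ∈ 𝓝 x := by
    apply extChartAt_preimage_mem_nhds_of_mem_nhdsWithin (by simp)
    rw [inter_comm]
    exact inter_mem_nhdsWithin _ (ball_mem_nhds _ r_pos)
  refine ⟨C, C_pos, _, inter_mem A (chart_source_mem_nhds H x), ?_⟩
  rintro y ⟨hy, h'y⟩ z ⟨hz, h'z⟩
  -- The competitor path is the straight segment in the chart, carried to the manifold; convexity of
  -- the ball and of the model range keeps it where the derivative bound holds.
  let η := ContinuousAffineMap.lineMap (R := ℝ) (extChartAt I x y) (extChartAt I x z)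
  set γ := (extChartAt I x).symm ∘ η
  have hη : Icc 0 1 ⊆ ⇑η ⁻¹' ((extChartAt I x).target ∩
        {y | ∀ v : E, ‖mfderiv[range I] (extChartAt I x).symm y v‖ₑ ≤ C * ‖v‖ₑ}) := by
    simp only [← image_subset_iff, ContinuousAffineMap.coe_lineMap_eq,
     ← segment_eq_image_lineMap, η]
    apply Subset.trans _ hr
    exact ((convex_ball _ _).inter I.convex_range).segment_subset hy hz
  simp only [preimage_inter, subset_inter_iff] at hη
  have η_smooth : CMDiff[Icc 0 1] 1 η := by
    apply ContMDiff.contMDiffOn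
    rw [contMDiff_iff_contDiff]
    exact ContinuousAffineMap.contDiff _
  have : riemannianEDist I y z ≤ pathELength I γ 0 1 := by
    apply riemannianEDist_le_pathELength _ _ _ zero_le_one
    · exact (contMDiffOn_extChartAt_symm x).comp η_smooth hη.1
    · simp [γ, η, ContinuousAffineMap.coe_lineMap_eq, h'y]
    · simp [γ, η, ContinuousAffineMap.coe_lineMap_eq, h'z]
  apply this.trans
  rw [← lintegral_fderiv_lineMap_eq_edist, pathELength_eq_lintegral_mfderivWithin_Icc,
    ← lintegral_const_mul' _ _ ENNReal.coe_ne_top]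
  apply setLIntegral_mono' measurableSet_Icc (fun t ht ↦ ?_)
  have : mfderiv[Icc 0 1] γ t =
      (mfderiv[range I] (extChartAt I x).symm (η t)) ∘L (mfderiv[Icc 0 1] η t) := by
    apply mfderivWithin_comp
    · exact mdifferentiableWithinAt_extChartAt_symm (hη.1 ht)
    · exact η_smooth.mdifferentiableOn one_ne_zero t ht
    · exact hη.1.trans (preimage_mono (extChartAt_target_subset_range x))
    · rw [uniqueMDiffWithinAt_iff_uniqueDiffWithinAt]
      exact uniqueDiffOn_Icc zero_lt_one t ht
  have : mfderiv[Icc 0 1] γ t 1 =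
      (mfderiv[range I] (extChartAt I x).symm (η t)) (mfderiv[Icc 0 1] η t 1) := congr($this 1)
  rw [this]
  refine (hη.2 ht _).trans ?_
  simp only [mfderivWithin_eq_fderivWithin]
  exact le_of_eq rfl

theorem isContinuousRiemannianBundle_of_contMDiff {E : Type*} [NormedAddCommGroup E]
    [NormedSpace ℝ E] {H : Type*} [TopologicalSpace H] (I : ModelWithCorners ℝ E H)
    {M : Type*} [TopologicalSpace M] [ChartedSpace H M]
    [Bundle.RiemannianBundle (fun x : M => TangentSpace I x)] [IsManifold I ∞ M]
    [IsContMDiffRiemannianBundle I ∞ E (fun x : M => TangentSpace I x)] :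
    IsContinuousRiemannianBundle E (fun x : M => TangentSpace I x) := by
  obtain ⟨g, hg, h⟩ := IsContMDiffRiemannianBundle.exists_contMDiff (IB := I) (n := ∞) (F := E)
    (E := fun x : M => TangentSpace I x)
  exact ⟨g, hg.continuous, h⟩

/-- A compact Riemannian manifold is a finite union of pieces, each of which carries coordinates
in the unit cube whose inverse is Lipschitz. -/
theorem exists_piecewise_coordinates (d : ℕ) (M : Type*) [MetricSpace M] [CompactSpace M]
    [ChartedSpace (EuclideanSpace ℝ (Fin d)) M] [IsManifold (𝓡 d) ∞ M]
    [Bundle.RiemannianBundle (fun x : M => TangentSpace (𝓡 d) x)]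
    [IsContMDiffRiemannianBundle (𝓡 d) ∞ (EuclideanSpace ℝ (Fin d))
      (fun x : M => TangentSpace (𝓡 d) x)]
    [IsRiemannianManifold (𝓡 d) M] :
    ∃ (P : ℕ) (K : ℝ) (a : M → Fin P) (u : M → Fin d → ℝ), 0 < K ∧
      (∀ x i, 0 ≤ u x i ∧ u x i < 1) ∧ ∀ x y, a x = a y → dist x y ≤ K * dist (u x) (u y) := by
  have : IsContinuousRiemannianBundle (EuclideanSpace ℝ (Fin d))
      (fun x : M => TangentSpace (𝓡 d) x) := isContinuousRiemannianBundle_of_contMDiff (𝓡 d)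
  have : IsManifold (𝓡 d) 1 M := IsManifold.of_le (n := ∞) (by simp)
  let e := (EuclideanSpace.equiv (Fin d) ℝ)
  have key : ∀ p : M, ∃ C : ℝ, 0 < C ∧ ∃ U ∈ 𝓝 p, ∃ u : M → Fin d → ℝ,
      (∀ x ∈ U, ∀ i, 0 ≤ u x i ∧ u x i < 1) ∧
      ∀ x ∈ U, ∀ y ∈ U, dist x y ≤ C * dist (u x) (u y) := by
    intro p
    obtain ⟨C, hC, U, hU, h⟩ := exists_nhds_riemannianEDist_le_edist_extChartAt (𝓡 d) p
    let φ : M → Fin d → ℝ := fun x => e (extChartAt (𝓡 d) p x)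
    have hφ : ContinuousAt φ p := e.continuous.continuousAt.comp (continuousAt_extChartAt p)
    have hV := inter_mem hU (hφ.preimage_mem_nhds (ball_mem_nhds _ one_pos))
    let D := ‖(e.symm : (Fin d → ℝ) →L[ℝ] EuclideanSpace ℝ (Fin d))‖
    -- On the neighbourhood each coordinate is within `1` of its value at `p`, so dividing by `4`
    -- and recentring at `1 / 2` lands in `[0, 1)`. The inverse pays the factor `4`, and `D` for the
    -- change of norm.
    refine ⟨4 * C * D + 1, by positivity, _, hV, fun x i => (φ x i - φ p i) / 4 + 1 / 2, ?_, ?_⟩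
    · rintro x ⟨-, hx⟩ i
      have h1 : dist (φ x i) (φ p i) < 1 := (dist_le_pi_dist _ _ i).trans_lt hx
      rw [Real.dist_eq, abs_lt] at h1
      constructor <;> linarith
    · rintro x ⟨hx, -⟩ y ⟨hy, -⟩
      have h1 : dist x y ≤ C * dist (extChartAt (𝓡 d) p x) (extChartAt (𝓡 d) p y) := by
        have := h x hx y hy
        rw [← IsRiemannianManifold.out (I := 𝓡 d) x y, edist_nndist, edist_nndist] at this
        exact_mod_cast this
      have h2 : dist (extChartAt (𝓡 d) p x) (extChartAt (𝓡 d) p y) ≤ D * dist (φ x) (φ y) := by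
        have := (e.symm : (Fin d → ℝ) →L[ℝ] EuclideanSpace ℝ (Fin d)).le_opNorm (φ x - φ y)
        rw [dist_eq_norm, dist_eq_norm]
        simpa [φ] using this
      have h3 : dist (φ x) (φ y) ≤ 4 * dist (fun i => (φ x i - φ p i) / 4 + 1 / 2)
          (fun i => (φ y i - φ p i) / 4 + 1 / 2) := by
        rw [dist_pi_le_iff (by positivity)]
        intro i
        have := dist_le_pi_dist (fun i => (φ x i - φ p i) / 4 + 1 / 2)
          (fun i => (φ y i - φ p i) / 4 + 1 / 2) i
        rw [Real.dist_eq] at this ⊢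
        rw [show (φ x i - φ p i) / 4 + 1 / 2 - ((φ y i - φ p i) / 4 + 1 / 2)
          = (φ x i - φ y i) / 4 by ring, abs_div, abs_of_pos (four_pos : (0 : ℝ) < 4)] at this
        linarith
      calc dist x y ≤ C * (D * (4 * _)) := h1.trans (by gcongr; exact h2.trans (by gcongr))
        _ ≤ _ := by
          have := dist_nonneg (x := fun i => (φ x i - φ p i) / 4 + 1 / 2)
            (y := fun i => (φ y i - φ p i) / 4 + 1 / 2)
          nlinarith
  choose C hC U hU u hu hdist using key
  obtain ⟨t, -, ht⟩ := isCompact_univ.elim_nhds_subcover U (fun p _ => hU p)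
  have hcov : ∀ x : M, ∃ p : t, x ∈ U p := by
    intro x
    obtain ⟨p, hp, hx⟩ := mem_iUnion₂.1 (ht (mem_univ x))
    exact ⟨⟨p, hp⟩, hx⟩
  choose b hb using hcov
  -- The sum dominates every `C p`; the `+ 1` keeps it positive when `t` is empty.
  refine ⟨t.card, ∑ p ∈ t, C p + 1, fun x => t.equivFin (b x), fun x => u (b x) x,
    by have := Finset.sum_nonneg (fun p (_ : p ∈ t) => (hC p).le); positivity,
    fun x => hu _ x (hb x), fun x y hxy => ?_⟩
  have hxy := t.equivFin.injective hxy
  have h1 := hdist (b x) x (hb x) y (hxy ▸ hb y)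
  have h2 : C (b x) ≤ ∑ p ∈ t, C p :=
    Finset.single_le_sum (f := C) (fun p _ => (hC p).le) (b x).2
  change dist x y ≤ _ * dist (u (b x) x) (u (b y) y)
  rw [← hxy]
  exact h1.trans (by gcongr; linarith)

end Chart

/-! ### Moments of independent signs -/

section SignMean

/-- The mean of a function of `n` independent uniform signs. -/
def signMean (n : ℕ) (g : (Fin n → ℤˣ) → ℝ) : ℝ := (1 / 2 ^ n) * ∑ σ, g σ

theorem signMean_mono {n : ℕ} {g h : (Fin n → ℤˣ) → ℝ} (hgh : ∀ σ, g σ ≤ h σ) :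
    signMean n g ≤ signMean n h :=
  mul_le_mul_of_nonneg_left (Finset.sum_le_sum fun σ _ => hgh σ) (by positivity)

theorem signMean_const (n : ℕ) (c : ℝ) : signMean n (fun _ => c) = c := by
  simp [signMean]

theorem signMean_add {n : ℕ} (g h : (Fin n → ℤˣ) → ℝ) :
    signMean n (fun σ => g σ + h σ) = signMean n g + signMean n h := by
  simp [signMean, Finset.sum_add_distrib, mul_add]

theorem signMean_const_mul {n : ℕ} (c : ℝ) (g : (Fin n → ℤˣ) → ℝ) :
    signMean n (fun σ => c * g σ) = c * signMean n g := by
  simp only [signMean, ← Finset.mul_sum]; ring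

theorem signMean_sum {n : ℕ} {ι : Type*} (s : Finset ι) (g : ι → (Fin n → ℤˣ) → ℝ) :
    signMean n (fun σ => ∑ j ∈ s, g j σ) = ∑ j ∈ s, signMean n (g j) := by
  simp only [signMean, ← Finset.mul_sum]
  rw [Finset.sum_comm]

theorem signMean_prod {n : ℕ} (h : Fin n → ℤˣ → ℝ) :
    signMean n (fun σ => ∏ i, h i (σ i)) = ∏ i, (h i 1 + h i (-1)) / 2 := by
  have : ∑ σ : Fin n → ℤˣ, ∏ i, h i (σ i) = ∏ i, ∑ s : ℤˣ, h i s := by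
    rw [Finset.prod_univ_sum, Fintype.piFinset_univ]
  rw [signMean, this, Finset.prod_div_distrib]
  simp [UnitsInt.univ, div_eq_inv_mul]

/-- Jensen's inequality for the exponential. -/
theorem exp_signMean_le {n : ℕ} (g : (Fin n → ℤˣ) → ℝ) :
    Real.exp (signMean n g) ≤ signMean n (fun σ => Real.exp (g σ)) := by
  have := convexOn_exp.map_sum_le (t := Finset.univ) (w := fun _ : Fin n → ℤˣ => (1 : ℝ) / 2 ^ n)
    (p := g) (by intros; positivity) (by simp) (by simp)
  simpa [signMean, Finset.mul_sum] using this

theorem sq_signMean_le {n : ℕ} (g : (Fin n → ℤˣ) → ℝ) :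
    signMean n g ^ 2 ≤ signMean n (fun σ => g σ ^ 2) := by
  have := (even_two.convexOn_pow (𝕜 := ℝ)).map_sum_le (t := Finset.univ)
    (w := fun _ : Fin n → ℤˣ => (1 : ℝ) / 2 ^ n)
    (p := g) (by intros; positivity) (by simp) (by simp)
  simpa [signMean, Finset.mul_sum] using this

/-- By independence the left side is `∏ cosh (a i)`, and `cosh t ≤ exp (t² / 2)`. -/
theorem signMean_exp_sum_le {n : ℕ} (a : Fin n → ℝ) :
    signMean n (fun σ => Real.exp (∑ i, ((σ i : ℤ) : ℝ) * a i)) ≤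
      Real.exp ((∑ i, a i ^ 2) / 2) := by
  simp only [Real.exp_sum]
  rw [signMean_prod fun i s => Real.exp (((s : ℤ) : ℝ) * a i), Finset.sum_div, Real.exp_sum]
  refine Finset.prod_le_prod (fun i _ => by positivity) fun i _ => ?_
  have := Real.cosh_le_exp_half_sq (a i)
  rw [Real.cosh_eq] at this
  simpa using this

/-- Massart's finite class lemma. -/
theorem signMean_sup'_le {n : ℕ} {ι : Type*} (A : Finset ι) (hA : A.Nonempty) (a : ι → Fin n → ℝ)
    {r : ℝ} (hr : 0 < r) (ha : ∀ t ∈ A, ∑ i, a t i ^ 2 ≤ r ^ 2) :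
    signMean n (fun σ => A.sup' hA fun t => ∑ i, ((σ i : ℤ) : ℝ) * a t i) ≤
      r * √(2 * Real.log A.card) := by
  set S := signMean n (fun σ => A.sup' hA fun t => ∑ i, ((σ i : ℤ) : ℝ) * a t i)
  have hcard : (1 : ℝ) ≤ A.card := by exact_mod_cast hA.card_pos
  have hlog := Real.log_nonneg hcard
  have key : ∀ l : ℝ, 0 < l → l * S ≤ Real.log A.card + (l * r) ^ 2 / 2 := by
    intro l hl
    rw [← Real.exp_le_exp, Real.exp_add, Real.exp_log (by linarith), ← signMean_const_mul]
    refine (exp_signMean_le _).trans ?_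
    have h1 : ∀ σ : Fin n → ℤˣ, Real.exp (l * A.sup' hA fun t => ∑ i, ((σ i : ℤ) : ℝ) * a t i) ≤
        ∑ t ∈ A, Real.exp (∑ i, ((σ i : ℤ) : ℝ) * (l * a t i)) := by
      intro σ
      obtain ⟨t, ht, h⟩ := Finset.exists_mem_eq_sup' hA fun t => ∑ i, ((σ i : ℤ) : ℝ) * a t i
      rw [h]
      refine le_trans (le_of_eq ?_) (Finset.single_le_sum
        (f := fun t => Real.exp (∑ i, ((σ i : ℤ) : ℝ) * (l * a t i)))
        (fun _ _ => (Real.exp_pos _).le) ht)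
      simp only [Finset.mul_sum]
      congr 2 with i
      ring
    refine (signMean_mono h1).trans ?_
    rw [signMean_sum, ← nsmul_eq_mul]
    refine Finset.sum_le_card_nsmul _ _ _ fun t ht => (signMean_exp_sum_le _).trans ?_
    gcongr
    simp only [mul_pow, ← Finset.mul_sum]
    exact mul_le_mul_of_nonneg_left (ha t ht) (by positivity)
  -- For a single vector the optimal `l` below degenerates to `0`; then `l = S / r²` contradicts `S
  -- > 0`.
  rcases hlog.eq_or_lt with h0 | h0
  · rw [← h0, mul_zero, Real.sqrt_zero, mul_zero]
    by_contra! hS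
    have := key (S / r ^ 2) (by positivity)
    rw [← h0] at this
    have e : (S / r ^ 2 * r) ^ 2 / 2 = S / r ^ 2 * S / 2 := by field_simp
    rw [e] at this
    have : 0 < S / r ^ 2 * S := by positivity
    linarith
  · set q := √(2 * Real.log A.card)
    have hq : 0 < q := Real.sqrt_pos.2 (by positivity)
    have hq2 : q ^ 2 = 2 * Real.log A.card := Real.sq_sqrt (by positivity)
    -- `l = q / r` minimises `log |A| / l + l r² / 2`.
    have := key (q / r) (by positivity)
    rw [show Real.log A.card = q ^ 2 / 2 by rw [hq2]; ring, div_mul_cancel₀ _ hr.ne',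
      div_mul_eq_mul_div, div_le_iff₀ hr] at this
    nlinarith

theorem signMean_sign_mul_sign {n : ℕ} (i j : Fin n) :
    signMean n (fun σ => ((σ i : ℤ) : ℝ) * ((σ j : ℤ) : ℝ)) = if i = j then 1 else 0 := by
  split_ifs with h
  · subst h
    have : ∀ s : ℤˣ, ((s : ℤ) : ℝ) * ((s : ℤ) : ℝ) = 1 := fun s => by
      rw [← Int.cast_mul, ← Units.val_mul, Int.units_mul_self]; simp
    simp only [this, signMean_const]
  -- Padding with factors `1` makes this a product over all indices, whose `i`-th factor has mean
  -- zero.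
  · have h1 : ∀ σ : Fin n → ℤˣ, ((σ i : ℤ) : ℝ) * ((σ j : ℤ) : ℝ) =
        ∏ k, (fun k (s : ℤˣ) => if k = i ∨ k = j then ((s : ℤ) : ℝ) else 1) k (σ k) := by
      intro σ
      rw [← Finset.prod_subset (Finset.subset_univ {i, j}), Finset.prod_pair h]
      · simp
      · intro k _ hk
        simp only [Finset.mem_insert, Finset.mem_singleton] at hk
        simp [hk]
    rw [funext h1, signMean_prod fun k (s : ℤˣ) => if k = i ∨ k = j then ((s : ℤ) : ℝ) else 1]
    exact Finset.prod_eq_zero (Finset.mem_univ i) (by simp)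

theorem signMean_sq_sum {n : ℕ} (b : Fin n → ℝ) :
    signMean n (fun σ => (∑ i, ((σ i : ℤ) : ℝ) * b i) ^ 2) = ∑ i, b i ^ 2 := by
  have h1 : ∀ σ : Fin n → ℤˣ, (∑ i, ((σ i : ℤ) : ℝ) * b i) ^ 2 =
      ∑ i, ∑ j, (b i * b j) * (((σ i : ℤ) : ℝ) * ((σ j : ℤ) : ℝ)) := by
    intro σ
    rw [sq, Finset.sum_mul_sum]
    exact Finset.sum_congr rfl fun i _ => Finset.sum_congr rfl fun j _ => by ring
  simp only [h1, signMean_sum, signMean_const_mul, signMean_sign_mul_sign]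
  simp [sq]

end SignMean

/-! ### Rademacher bound for linear functionals of features -/

section Linear

variable {X : Type*}

theorem empiricalRademacher_eq_signMean (F : Set (X → ℝ)) {n : ℕ} (x : Fin n → X) :
    empiricalRademacher F x =
      signMean n (fun σ => ⨆ f : F, (1 / (n : ℝ)) * ∑ i, ((σ i : ℤ) : ℝ) * f.1 (x i)) := rfl

theorem abs_sign_eq_one (s : ℤˣ) : |((s : ℤ) : ℝ)| = 1 := by
  rcases Int.units_eq_one_or s with h | h <;> simp [h]

theorem sum_sign_mul_le {n : ℕ} (σ : Fin n → ℤˣ) {b : Fin n → ℝ} {δ : ℝ} (hb : ∀ i, |b i| ≤ δ) :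
    ∑ i, ((σ i : ℤ) : ℝ) * b i ≤ n * δ := by
  calc ∑ i, ((σ i : ℤ) : ℝ) * b i ≤ ∑ _i : Fin n, δ := Finset.sum_le_sum fun i _ => by
        refine (le_abs_self _).trans ?_
        rw [abs_mul, abs_sign_eq_one, one_mul]
        exact hb i
    _ = n * δ := by simp

/-- The empirical Rademacher complexity of a class that is uniformly close to a bounded set of
linear functionals of a feature map. -/
theorem empiricalRademacher_le_of_features {ι : Type*} [Fintype ι] {F : Set (X → ℝ)}
    (hF : F.Nonempty) {n : ℕ} (hn : 1 ≤ n) (x : Fin n → X) (Φ : X → ι → ℝ) {δ R ρ : ℝ}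
    (hR : 0 ≤ R) (hΦ : ∀ x, ∑ e, Φ x e ^ 2 ≤ ρ)
    (hF' : ∀ f ∈ F, ∃ v : ι → ℝ, ∑ e, v e ^ 2 ≤ R ^ 2 ∧ ∀ x, |f x - ∑ e, v e * Φ x e| ≤ δ) :
    empiricalRademacher F x ≤ δ + R * √(ρ / n) := by
  have hn' : (0 : ℝ) < n := by exact_mod_cast hn
  have : Nonempty F := hF.to_subtype
  set Y : (Fin n → ℤˣ) → ℝ := fun σ => √(∑ e, (∑ i, ((σ i : ℤ) : ℝ) * Φ (x i) e) ^ 2)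
  have h1 : ∀ σ : Fin n → ℤˣ, (⨆ f : F, (1 / (n : ℝ)) * ∑ i, ((σ i : ℤ) : ℝ) * f.1 (x i)) ≤
      δ + (R / n) * Y σ := by
    intro σ
    refine ciSup_le fun f => ?_
    obtain ⟨v, hv, hfv⟩ := hF' f.1 f.2
    -- The approximation error is separated from the linear part, where summing over the sample
    -- first lets Cauchy–Schwarz bound all `v` at once.
    have e1 : ∑ i, ((σ i : ℤ) : ℝ) * f.1 (x i) =
        ∑ i, ((σ i : ℤ) : ℝ) * (f.1 (x i) - ∑ e, v e * Φ (x i) e) +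
          ∑ e, v e * ∑ i, ((σ i : ℤ) : ℝ) * Φ (x i) e := by
      simp only [mul_sub, Finset.sum_sub_distrib, Finset.mul_sum]
      rw [Finset.sum_comm (s := (Finset.univ : Finset ι))]
      rw [sub_add, sub_eq_self.2]
      rw [sub_eq_zero]
      exact Finset.sum_congr rfl fun i _ => Finset.sum_congr rfl fun e _ => by ring
    have e2 := sum_sign_mul_le σ fun i => hfv (x i)
    have e3 : ∑ e, v e * ∑ i, ((σ i : ℤ) : ℝ) * Φ (x i) e ≤ R * Y σ := by
      refine (Real.sum_mul_le_sqrt_mul_sqrt _ _ _).trans ?_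
      refine mul_le_mul_of_nonneg_right ?_ (Real.sqrt_nonneg _)
      exact Real.sqrt_le_iff.2 ⟨hR, hv⟩
    rw [e1, one_div, inv_mul_le_iff₀ hn', mul_add, ← mul_assoc, mul_div_cancel₀ _ hn'.ne']
    linarith
  rw [empiricalRademacher_eq_signMean]
  refine (signMean_mono h1).trans ?_
  rw [signMean_add, signMean_const, signMean_const_mul]
  have h2 : signMean n Y ≤ √(n * ρ) := by
    refine Real.le_sqrt_of_sq_le ((sq_signMean_le _).trans ?_)
    have : ∀ σ, Y σ ^ 2 = ∑ e, (∑ i, ((σ i : ℤ) : ℝ) * Φ (x i) e) ^ 2 := fun σ =>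
      Real.sq_sqrt (Finset.sum_nonneg fun _ _ => sq_nonneg _)
    simp only [this]
    rw [signMean_sum]
    simp only [signMean_sq_sum]
    rw [Finset.sum_comm]
    calc ∑ i : Fin n, ∑ e, Φ (x i) e ^ 2 ≤ ∑ _i : Fin n, ρ := Finset.sum_le_sum fun i _ => hΦ _
      _ = n * ρ := by simp
  have h3 : √(n * ρ) = n * √(ρ / n) := by
    rw [show (n : ℝ) * ρ = n ^ 2 * (ρ / n) by field_simp, Real.sqrt_mul (by positivity),
      Real.sqrt_sq hn'.le]
  have h4 : R / n * signMean n Y ≤ R / n * (n * √(ρ / n)) := by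
    rw [← h3]; gcongr
  rw [show R / n * (n * √(ρ / n)) = R * √(ρ / n) by field_simp] at h4
  linarith

end Linear

/-! ### Covering numbers in the sup norm -/

section Covering

variable {X : Type*}

theorem isCover_ofFun_iff {F : Set (X → ℝ)} {ε : ℝ} (hε : 0 ≤ ε) {C : Set (X →ᵤ ℝ)} :
    IsCover ε.toNNReal (UniformFun.ofFun '' F : Set (X →ᵤ ℝ)) C ↔
      ∀ f ∈ F, ∃ c ∈ C, ∀ x, |f x - UniformFun.toFun c x| ≤ ε := by
  have h : ∀ (f : X → ℝ) (c : X →ᵤ ℝ), edist (UniformFun.ofFun f) c ≤ ε.toNNReal ↔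
      ∀ x, |f x - UniformFun.toFun c x| ≤ ε := by
    intro f c
    rw [UniformFun.edist_le]
    refine forall_congr' fun x => ?_
    rw [edist_dist, Real.dist_eq]
    exact ENNReal.ofReal_le_ofReal_iff hε
  constructor
  · intro hC f hf
    obtain ⟨c, hc, hfc⟩ := hC (mem_image_of_mem _ hf)
    exact ⟨c, hc, (h f c).1 hfc⟩
  · rintro hC _ ⟨f, hf, rfl⟩
    obtain ⟨c, hc, hfc⟩ := hC f hf
    exact ⟨c, hc, (h f c).2 hfc⟩

theorem supCoveringNumber_le_card {F : Set (X → ℝ)} {ε : ℝ} (hε : 0 ≤ ε) (C : Finset (X → ℝ))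
    (hC : ∀ f ∈ F, ∃ c ∈ C, ∀ x, |f x - c x| ≤ ε) : supCoveringNumber F ε ≤ C.card := by
  have := IsCover.externalCoveringNumber_le_encard (A := (UniformFun.ofFun '' F : Set (X →ᵤ ℝ)))
    (C := UniformFun.ofFun '' (C : Set (X → ℝ))) (ε := ε.toNNReal)
    ((isCover_ofFun_iff hε).2 fun f hf => by
      obtain ⟨c, hc, h⟩ := hC f hf
      exact ⟨_, mem_image_of_mem _ hc, h⟩)
  refine this.trans ((Set.encard_image_le _ _).trans ?_)
  rw [Set.encard_coe_eq_coe_finsetCard]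

/-- An infimum in `ℕ∞` is attained. -/
theorem exists_cover_card_eq {F : Set (X → ℝ)} {ε : ℝ} (hε : 0 ≤ ε)
    (hfin : supCoveringNumber F ε ≠ ⊤) :
    ∃ C : Finset (X → ℝ), C.card = (supCoveringNumber F ε).toNat ∧
      ∀ f ∈ F, ∃ c ∈ C, ∀ x, |f x - c x| ≤ ε := by
  have hne : Nonempty {C : Set (X →ᵤ ℝ) //
      IsCover ε.toNNReal (UniformFun.ofFun '' F : Set (X →ᵤ ℝ)) C} := ⟨⟨_, IsCover.rfl⟩⟩
  obtain ⟨⟨C, hC⟩, hcard⟩ := ENat.exists_eq_iInf fun C : {C : Set (X →ᵤ ℝ) //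
      IsCover ε.toNNReal (UniformFun.ofFun '' F : Set (X →ᵤ ℝ)) C} => C.1.encard
  have hcard' : C.encard = supCoveringNumber F ε := by
    rw [supCoveringNumber, externalCoveringNumber, iInf_subtype']
    exact hcard
  have hCfin : C.Finite := by
    rw [← Set.encard_ne_top_iff, hcard']; exact hfin
  classical
  have hinj : Function.Injective (UniformFun.toFun : (X →ᵤ ℝ) → X → ℝ) :=
    UniformFun.toFun.injective
  refine ⟨hCfin.toFinset.image UniformFun.toFun, ?_, fun f hf => ?_⟩
  · rw [Finset.card_image_of_injective _ hinj, ← hcard', hCfin.encard_eq_coe_toFinset_card,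
      ENat.toNat_natCast]
  · obtain ⟨c, hc, h⟩ := (isCover_ofFun_iff hε).1 hC f hf
    exact ⟨_, Finset.mem_image_of_mem _ (hCfin.mem_toFinset.2 hc), h⟩

theorem supCoveringNumber_anti (F : Set (X → ℝ)) {ε δ : ℝ} (h : ε ≤ δ) :
    supCoveringNumber F δ ≤ supCoveringNumber F ε :=
  externalCoveringNumber_anti (Real.toNNReal_le_toNNReal h)

theorem one_le_toNat_supCoveringNumber {F : Set (X → ℝ)} (hF : F.Nonempty) {ε : ℝ}
    (hfin : supCoveringNumber F ε ≠ ⊤) : 1 ≤ (supCoveringNumber F ε).toNat := by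
  have : 0 < supCoveringNumber F ε := externalCoveringNumber_pos_iff.2 (hF.image _)
  rw [Nat.one_le_iff_ne_zero, Ne, ENat.toNat_eq_zero]
  exact not_or.2 ⟨this.ne', hfin⟩

theorem supCoveringNumber_of_le {F : Set (X → ℝ)} {B ε : ℝ} (hB : 0 ≤ B)
    (hFB : ∀ f ∈ F, ∀ x, |f x| ≤ B) (h : B ≤ ε) : supCoveringNumber F ε ≤ 1 := by
  simpa using supCoveringNumber_le_card (hB.trans h) {0}
    fun f hf => ⟨0, by simp, fun x => by simpa using (hFB f hf x).trans h⟩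

theorem sqrtEntropy_nonneg (F : Set (X → ℝ)) (ε : ℝ) : 0 ≤ sqrtEntropy F ε := Real.sqrt_nonneg _

theorem sqrtEntropy_anti {F : Set (X → ℝ)} (hF : F.Nonempty)
    (hfin : ∀ ε : ℝ, 0 < ε → supCoveringNumber F ε ≠ ⊤) {ε δ : ℝ} (hε : 0 < ε) (h : ε ≤ δ) :
    sqrtEntropy F δ ≤ sqrtEntropy F ε := by
  have h1 := one_le_toNat_supCoveringNumber hF (hfin δ (hε.trans_le h))
  -- `toNat` sends `⊤` to `0`, so monotonicity needs finiteness at the smaller scale.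
  have h2 := ENat.toNat_le_toNat (supCoveringNumber_anti F h) (hfin ε hε)
  exact Real.sqrt_le_sqrt (Real.log_le_log (by exact_mod_cast h1) (by exact_mod_cast h2))

theorem sqrtEntropy_of_le {F : Set (X → ℝ)} {B ε : ℝ} (hB : 0 ≤ B)
    (hFB : ∀ f ∈ F, ∀ x, |f x| ≤ B) (h : B ≤ ε) : sqrtEntropy F ε = 0 := by
  have h1 : (supCoveringNumber F ε).toNat ≤ 1 :=
    ENat.toNat_le_toNat (supCoveringNumber_of_le hB hFB h) (by simp)
  rw [sqrtEntropy]
  interval_cases (supCoveringNumber F ε).toNat <;> simp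

theorem intervalIntegrable_sqrtEntropy {F : Set (X → ℝ)} (hF : F.Nonempty)
    (hfin : ∀ ε : ℝ, 0 < ε → supCoveringNumber F ε ≠ ⊤) {a b : ℝ} (ha : 0 < a) (hb : 0 < b) :
    IntervalIntegrable (sqrtEntropy F) volume a b := by
  refine AntitoneOn.intervalIntegrable fun x hx y _ hxy => ?_
  exact sqrtEntropy_anti hF hfin ((lt_min ha hb).trans_le hx.1) hxy

/-- Piecewise constant approximation: if the domain splits into `k` pieces on each of which the
functions oscillate by at most `ε / 2`, then at scale `ε` the class has entropy `O(k log (1/ε))`. -/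
theorem supCoveringNumber_le_of_partition {F : Set (X → ℝ)} {B ε : ℝ} (hε : 0 < ε)
    (hFB : ∀ f ∈ F, ∀ x, |f x| ≤ B) {κ : Type*} [Fintype κ] (c : X → κ)
    (hc : ∀ f ∈ F, ∀ x y, c x = c y → |f x - f y| ≤ ε / 2) :
    supCoveringNumber F ε ≤ ((2 * ⌈B / ε⌉₊ + 1) ^ Fintype.card κ : ℕ) := by
  classical
  set m := ⌈B / ε⌉₊
  set C : Finset (X → ℝ) := (Finset.univ : Finset (κ → Fin (2 * m + 1))).image
    fun q x => ε * (((q (c x) : ℕ) : ℝ) - m)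
  have hcard : C.card ≤ (2 * m + 1) ^ Fintype.card κ := by
    refine Finset.card_image_le.trans ?_
    simp
  refine (supCoveringNumber_le_card hε.le C fun f hf => ?_).trans (by exact_mod_cast hcard)
  have key : ∀ t : κ, ∃ q : Fin (2 * m + 1), ∀ x, c x = t → |f x - ε * (((q : ℕ) : ℝ) - m)| ≤ ε := by
    intro t
    by_cases ht : ∃ y, c y = t
    · obtain ⟨y, rfl⟩ := ht
      have hm : B / ε ≤ m := Nat.le_ceil _
      rw [div_le_iff₀ hε] at hm
      obtain ⟨hy1, hy2⟩ := abs_le.1 (hFB f hf y)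
      -- The `1 / 2` turns the floor into rounding to nearest: error at most `ε / 2`, to which the
      -- oscillation on the piece adds another `ε / 2`.
      set w := f y / ε + m + 1 / 2
      have hw : f y / ε * ε = f y := div_mul_cancel₀ _ hε.ne'
      have hw0 : 0 ≤ w := by
        by_contra! h
        have : w * ε < 0 := mul_neg_of_neg_of_pos h hε
        simp only [w, add_mul, hw] at this
        linarith
      have hwm : w < ((2 * m + 1 : ℕ) : ℝ) := by
        by_contra! h
        have := mul_le_mul_of_nonneg_right h hε.le
        simp only [w, add_mul, hw] at this
        push_cast at this
        linarith
      refine ⟨⟨⌊w⌋₊, (Nat.floor_lt hw0).2 hwm⟩, fun x hx => ?_⟩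
      have h1 := mul_le_mul_of_nonneg_right (Nat.floor_le hw0) hε.le
      have h2 := mul_le_mul_of_nonneg_right (Nat.lt_floor_add_one w).le hε.le
      have e : w * ε = f y + m * ε + ε / 2 := by simp only [w, add_mul, hw]; ring
      rw [e] at h1 h2
      have h3 := abs_le.1 (hc f hf x y hx)
      rw [abs_le]
      constructor <;> simp only <;> linarith [h3.1, h3.2]
    · exact ⟨0, fun x hx => (ht ⟨x, hx⟩).elim⟩
  choose q hq using key
  exact ⟨_, Finset.mem_image_of_mem _ (Finset.mem_univ q), fun x => hq (c x) x rfl⟩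

end Covering

/-! ### Chaining and the entropy integral -/

section Dudley

variable {X : Type*}

/-- With `ε_j = B / 2^(j+1)`, the `j`-th term is twice the area of the rectangle of height
`sqrtEntropy F ε_j` over `[ε_j / 2, ε_j]`, which lies under the graph because the entropy decreases.
-/
theorem sum_sqrtEntropy_le_integral {F : Set (X → ℝ)} (hF : F.Nonempty)
    (hfin : ∀ ε : ℝ, 0 < ε → supCoveringNumber F ε ≠ ⊤) {B : ℝ} (hB : 0 < B) (J : ℕ) :
    ∑ j ∈ Finset.range J, B * (1 / 2) ^ (j + 1) * sqrtEntropy F (B * (1 / 2) ^ (j + 1)) ≤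
      2 * ∫ ε in (B * (1 / 2) ^ (J + 1))..(B / 2), sqrtEntropy F ε := by
  induction J with
  | zero => simp [div_eq_mul_inv]
  | succ J ih =>
    rw [Finset.sum_range_succ]
    have h1 : (0 : ℝ) < B * (1 / 2) ^ (J + 1) := by positivity
    have h2 : (0 : ℝ) < B * (1 / 2) ^ (J + 1 + 1) := by positivity
    have e : B * (1 / 2 : ℝ) ^ (J + 1 + 1) = B * (1 / 2) ^ (J + 1) / 2 := by ring
    have hI := intervalIntegrable_sqrtEntropy hF hfin h2 h1
    rw [← intervalIntegral.integral_add_adjacent_intervals hI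
      (intervalIntegrable_sqrtEntropy hF hfin h1 (half_pos hB)), mul_add, add_comm]
    refine add_le_add ?_ ih
    have := intervalIntegral.integral_mono_on (a := B * (1 / 2 : ℝ) ^ (J + 1 + 1))
      (b := B * (1 / 2 : ℝ) ^ (J + 1)) (f := fun _ => sqrtEntropy F (B * (1 / 2) ^ (J + 1)))
      (by linarith) (by simp) hI
      (fun x hx => sqrtEntropy_anti hF hfin (h2.trans_le hx.1) hx.2)
    rw [intervalIntegral.integral_const, smul_eq_mul] at this
    rw [e] at this ⊢
    linarith

theorem empiricalRademacher_le_of_abs_le {F : Set (X → ℝ)} (hF : F.Nonempty) {B : ℝ}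
    (hFB : ∀ f ∈ F, ∀ x, |f x| ≤ B) {n : ℕ} (hn : 1 ≤ n) (x : Fin n → X) :
    empiricalRademacher F x ≤ B := by
  have := empiricalRademacher_le_of_features (ι := Empty) hF hn x (fun _ e => e.elim)
    (δ := B) (R := 0) (ρ := 0) le_rfl (by simp)
    (fun f hf => ⟨fun e => e.elim, by simp, fun x => by simpa using hFB f hf x⟩)
  simpa using this

/-- Chaining along the dyadic scales `B / 2 ^ j`, `j ≤ J`. -/
theorem empiricalRademacher_le_chaining {F : Set (X → ℝ)} (hF : F.Nonempty)
    (hfin : ∀ ε : ℝ, 0 < ε → supCoveringNumber F ε ≠ ⊤) {B : ℝ} (hB : 0 < B)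
    (hFB : ∀ f ∈ F, ∀ x, |f x| ≤ B) {n : ℕ} (hn : 1 ≤ n) (x : Fin n → X) (J : ℕ) :
    empiricalRademacher F x ≤ B * (1 / 2) ^ J + 6 / √n *
      ∑ j ∈ Finset.range J, B * (1 / 2) ^ (j + 1) * sqrtEntropy F (B * (1 / 2) ^ (j + 1)) := by
  classical
  have hn' : (0 : ℝ) < n := by exact_mod_cast hn
  have : Nonempty F := hF.to_subtype
  have hcov : ∀ j : ℕ, ∃ C : Finset (X → ℝ),
      C.card = (supCoveringNumber F (B * (1 / 2) ^ j)).toNat ∧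
      (∀ f ∈ F, ∃ c ∈ C, ∀ x, |f x - c x| ≤ B * (1 / 2) ^ j) ∧ (j = 0 → C = {0}) := by
    intro j
    obtain ⟨C, h1, h2⟩ := exists_cover_card_eq (F := F) (ε := B * (1 / 2) ^ j) (by positivity)
      (hfin _ (by positivity))
    rcases Nat.eq_zero_or_pos j with rfl | hj
    -- At scale `B` the zero function alone is a cover, so every chain starts at `0`.
    · refine ⟨{0}, ?_, fun f hf => ⟨0, by simp, by simpa using hFB f hf⟩, fun _ => rfl⟩
      refine le_antisymm ?_ ?_
      · rw [Finset.card_singleton]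
        exact one_le_toNat_supCoveringNumber hF (hfin _ (by positivity))
      · exact ENat.toNat_le_toNat (supCoveringNumber_of_le hB.le hFB (by simp)) (by simp)
    · exact ⟨C, h1, h2, fun h => (hj.ne' h).elim⟩
  choose C hcard hC hC0 using hcov
  have hproj : ∀ (j : ℕ) (f : F), ∃ c ∈ C j, ∀ x, |f.1 x - c x| ≤ B * (1 / 2) ^ j :=
    fun j f => hC j f.1 f.2
  choose pr hpr hprf using hproj
  -- Only links short on the sample are kept. Links of actual chains qualify: `ε + 2ε = 3ε` with `ε
  -- = B / 2^(j+1)`.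
  set A : ℕ → Finset ((X → ℝ) × (X → ℝ)) := fun j =>
    (C (j + 1) ×ˢ C j).filter fun p => ∀ i, |p.1 (x i) - p.2 (x i)| ≤ 3 * (B * (1 / 2) ^ (j + 1))
  have hmem : ∀ j (f : F), (pr (j + 1) f, pr j f) ∈ A j := by
    intro j f
    refine Finset.mem_filter.2 ⟨Finset.mk_mem_product (hpr _ _) (hpr _ _), fun i => ?_⟩
    have h1 := abs_le.1 (hprf (j + 1) f (x i))
    have h2 := abs_le.1 (hprf j f (x i))
    have e : B * (1 / 2 : ℝ) ^ j = 2 * (B * (1 / 2) ^ (j + 1)) := by ring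
    rw [e] at h2
    rw [abs_le]
    constructor <;> simp only <;> linarith [h1.1, h1.2, h2.1, h2.2]
  have hne : ∀ j, (A j).Nonempty := fun j => ⟨_, hmem j (Classical.arbitrary F)⟩
  set Y : ℕ → (Fin n → ℤˣ) → ℝ := fun j σ => (A j).sup' (hne j)
    fun p => ∑ i, ((σ i : ℤ) : ℝ) * (p.1 (x i) - p.2 (x i))
  have hY : ∀ j, signMean n (Y j) ≤
      n * (6 / √n * (B * (1 / 2) ^ (j + 1) * sqrtEntropy F (B * (1 / 2) ^ (j + 1)))) := by
    intro j
    set ε := B * (1 / 2 : ℝ) ^ (j + 1) with hε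
    have hε0 : 0 < ε := by positivity
    have hsq : √(n : ℝ) ^ 2 = n := Real.sq_sqrt hn'.le
    have hs0 : 0 < √(n : ℝ) := Real.sqrt_pos.2 hn'
    have h1 := signMean_sup'_le (A j) (hne j) (fun p i => p.1 (x i) - p.2 (x i))
      (r := 3 * ε * √n) (by positivity) (fun p hp => by
        have hp' := (Finset.mem_filter.1 hp).2
        calc ∑ i, (p.1 (x i) - p.2 (x i)) ^ 2 ≤ ∑ _i : Fin n, (3 * ε) ^ 2 :=
              Finset.sum_le_sum fun i _ => sq_le_sq' (abs_le.1 (hp' i)).1 (abs_le.1 (hp' i)).2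
          _ = (3 * ε * √n) ^ 2 := by
              rw [Finset.sum_const, Finset.card_univ, Fintype.card_fin, nsmul_eq_mul, mul_pow _ √_,
                hsq]
              ring)
    refine h1.trans ?_
    have hNpos : 1 ≤ (supCoveringNumber F ε).toNat :=
      one_le_toNat_supCoveringNumber hF (hfin _ hε0)
    have hc : (A j).card ≤ (supCoveringNumber F ε).toNat ^ 2 := by
      refine (Finset.card_filter_le _ _).trans ?_
      rw [Finset.card_product, hcard, hcard, sq]
      refine Nat.mul_le_mul_left _ (ENat.toNat_le_toNat (supCoveringNumber_anti F ?_)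
        (hfin _ hε0))
      rw [hε, pow_succ]
      have : 0 < B * (1 / 2 : ℝ) ^ j := by positivity
      linarith
    have hlog : Real.log (A j).card ≤ 2 * Real.log (supCoveringNumber F ε).toNat := by
      have := Real.log_le_log (by exact_mod_cast (hne j).card_pos)
        (show ((A j).card : ℝ) ≤ ((supCoveringNumber F ε).toNat : ℝ) ^ 2 by exact_mod_cast hc)
      rwa [Real.log_pow] at this
    -- There are at most `N²` links, so the root is at most `√(4 log N)`; with the radius `3 ε √n`
    -- this produces the constant `6`.
    have h2 : √(2 * Real.log (A j).card) ≤ 2 * sqrtEntropy F ε := by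
      rw [sqrtEntropy, show (2 : ℝ) = √(2 ^ 2) from (Real.sqrt_sq two_pos.le).symm,
        ← Real.sqrt_mul (by positivity), Real.sqrt_sq two_pos.le]
      exact Real.sqrt_le_sqrt (by linarith)
    calc 3 * ε * √n * √(2 * Real.log (A j).card) ≤ 3 * ε * √n * (2 * sqrtEntropy F ε) := by gcongr
      _ = n * (6 / √n * (ε * sqrtEntropy F ε)) := by
        field_simp
        rw [hsq]
        ring
  have h1 : ∀ σ : Fin n → ℤˣ, (⨆ f : F, (1 / (n : ℝ)) * ∑ i, ((σ i : ℤ) : ℝ) * f.1 (x i)) ≤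
      B * (1 / 2) ^ J + (1 / (n : ℝ)) * ∑ j ∈ Finset.range J, Y j σ := by
    intro σ
    refine ciSup_le fun f => ?_
    have e0 : pr 0 f = 0 := by
      have := hpr 0 f
      rw [hC0 0 rfl] at this
      exact Finset.mem_singleton.1 this
    have e1 : ∑ i, ((σ i : ℤ) : ℝ) * f.1 (x i) = ∑ i, ((σ i : ℤ) : ℝ) * (f.1 (x i) - pr J f (x i)) +
        ∑ j ∈ Finset.range J, ∑ i, ((σ i : ℤ) : ℝ) * (pr (j + 1) f (x i) - pr j f (x i)) := by
      rw [Finset.sum_comm, ← Finset.sum_add_distrib]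
      refine Finset.sum_congr rfl fun i _ => ?_
      rw [← Finset.mul_sum, Finset.sum_range_sub (fun j => pr j f (x i)), e0, Pi.zero_apply]
      ring
    have e2 := sum_sign_mul_le σ fun i => hprf J f (x i)
    have e3 : ∑ j ∈ Finset.range J, ∑ i, ((σ i : ℤ) : ℝ) * (pr (j + 1) f (x i) - pr j f (x i)) ≤
        ∑ j ∈ Finset.range J, Y j σ :=
      Finset.sum_le_sum fun j _ => Finset.le_sup'
        (fun p : (X → ℝ) × (X → ℝ) => ∑ i, ((σ i : ℤ) : ℝ) * (p.1 (x i) - p.2 (x i))) (hmem j f)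
    rw [e1, one_div, inv_mul_le_iff₀ hn', mul_add, mul_inv_cancel_left₀ hn'.ne']
    linarith
  rw [empiricalRademacher_eq_signMean]
  refine (signMean_mono h1).trans ?_
  rw [signMean_add, signMean_const, signMean_const_mul, signMean_sum]
  refine add_le_add_right ?_ _
  rw [one_div (n : ℝ)]
  rw [inv_mul_le_iff₀ hn', Finset.mul_sum, Finset.mul_sum]
  exact Finset.sum_le_sum fun j _ => hY j

/-- Dudley's entropy integral bound, for every sample. -/
theorem empiricalRademacher_le_dudleyBound {F : Set (X → ℝ)} (hF : F.Nonempty)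
    (hfin : ∀ ε : ℝ, 0 < ε → supCoveringNumber F ε ≠ ⊤) {B : ℝ} (hB : 0 < B)
    (hFB : ∀ f ∈ F, ∀ x, |f x| ≤ B) {n : ℕ} (hn : 1 ≤ n) (x : Fin n → X) {α : ℝ} (hα : 0 < α) :
    empiricalRademacher F x ≤ dudleyBound F B n α := by
  rw [dudleyBound]
  rcases le_or_gt α (B / 2) with h | h
  -- The last scale satisfies `B / 2^(J+2) < α ≤ B / 2^(J+1)`: the residual `B / 2^J` is below `4
  -- α`, and the integral starts no lower than `α`.
  · obtain ⟨J, hJ1, hJ2⟩ := exists_nat_pow_near_of_lt_one (x := α / (B / 2)) (y := (1 / 2 : ℝ))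
      (by positivity) (by rw [div_le_one (by positivity)]; exact h) (by norm_num) (by norm_num)
    rw [lt_div_iff₀ (by positivity)] at hJ1
    rw [div_le_iff₀ (by positivity)] at hJ2
    have e1 : B * (1 / 2 : ℝ) ^ J < 4 * α := by rw [pow_succ] at hJ1; linarith
    have e2 : α ≤ B * (1 / 2 : ℝ) ^ (J + 1) := by rw [pow_succ]; linarith
    refine (empiricalRademacher_le_chaining hF hfin hB hFB hn x J).trans ?_
    refine add_le_add e1.le ?_
    have h1 := sum_sqrtEntropy_le_integral hF hfin hB J
    have h2 : ∫ ε in (B * (1 / 2) ^ (J + 1))..(B / 2), sqrtEntropy F ε ≤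
        ∫ ε in α..B, sqrtEntropy F ε := by
      refine intervalIntegral.integral_mono_interval e2 ?_ (by linarith)
        (Filter.Eventually.of_forall fun ε => sqrtEntropy_nonneg F ε)
        (intervalIntegrable_sqrtEntropy hF hfin hα hB)
      rw [pow_succ]
      have : (1 / 2 : ℝ) ^ J ≤ 1 := pow_le_one₀ (by norm_num) (by norm_num)
      nlinarith
    calc _ ≤ 6 / √(n : ℝ) * (2 * ∫ ε in α..B, sqrtEntropy F ε) := by
          gcongr; exact h1.trans (by gcongr)
      _ = _ := by ring
  -- Here `4 α > B`, so the trivial bound suffices. For `α > B` the reversed integral vanishes,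
  -- since the entropy is zero beyond `B`.
  · refine (empiricalRademacher_le_of_abs_le hF hFB hn x).trans ?_
    have : 0 ≤ ∫ ε in α..B, sqrtEntropy F ε := by
      rcases le_total α B with h' | h'
      · exact intervalIntegral.integral_nonneg h' fun ε _ => sqrtEntropy_nonneg F ε
      · rw [intervalIntegral.integral_symm, intervalIntegral.integral_congr (g := fun _ => 0)]
        · simp
        · intro ε hε
          rw [uIcc_of_le h'] at hε
          exact sqrtEntropy_of_le hB.le hFB hε.1
    have h2 : 0 ≤ 12 / √(n : ℝ) * ∫ ε in α..B, sqrtEntropy F ε := by positivity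
    linarith

end Dudley

/-! ### A unit flow of logarithmic energy on the planar grid -/

section PlanarFlow

/-- The unit flow on the quadrant `ℕ × ℕ` that spreads the mass from the origin uniformly over
successive antidiagonals: the amount that enters `(i, j)` from `(i - 1, j)`. -/
def quadrantFlow (i j : ℕ) : ℝ := i / ((i + j) * (i + j + 1))

/-- With `s = i + j`, a node other than the origin receives `1 / (s + 1)` and emits `1 / (s + 1)`.
At the origin the inflow is `0 / 0 = 0` and the outflow is `1`. -/
theorem quadrantFlow_divergence (i j : ℕ) :
    quadrantFlow i j + quadrantFlow j i - quadrantFlow (i + 1) j - quadrantFlow (j + 1) i =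
      if i = 0 ∧ j = 0 then -1 else 0 := by
  unfold quadrantFlow
  split_ifs with h
  · obtain ⟨rfl, rfl⟩ := h
    norm_num
  · have : 0 < i + j := by omega
    have h0 : (0 : ℝ) < i + j := by exact_mod_cast this
    have h1 : (j : ℝ) + i ≠ 0 := by linarith
    have h2 : (i : ℝ) + 1 + j ≠ 0 := by linarith
    have h3 : (j : ℝ) + 1 + i ≠ 0 := by linarith
    have h4 : (i : ℝ) + 1 + j + 1 ≠ 0 := by linarith
    have h5 : (j : ℝ) + 1 + i + 1 ≠ 0 := by linarith
    have h6 : (i : ℝ) + j + 1 ≠ 0 := by linarith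
    push_cast
    rw [show (j : ℝ) + i = i + j by ring, show (i : ℝ) + 1 + j = i + j + 1 by ring,
      show (j : ℝ) + 1 + i = i + j + 1 by ring]
    field_simp
    ring

theorem quadrantFlow_nonneg (i j : ℕ) : 0 ≤ quadrantFlow i j := by
  unfold quadrantFlow; positivity

theorem quadrantFlow_succ_le (i j : ℕ) : quadrantFlow (i + 1) j ≤ 1 / (i + j + 1) := by
  unfold quadrantFlow
  push_cast
  rw [div_le_div_iff₀ (by positivity) (by positivity)]
  have hi : (0 : ℝ) ≤ i := i.cast_nonneg
  have hj : (0 : ℝ) ≤ j := j.cast_nonneg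
  nlinarith [mul_nonneg hi hj]

/-- Summation by parts; both boundary terms vanish, one because no flow enters index `0`, the other
by `hg`. -/
theorem sum_quadrantFlow_mul_sub (T : ℕ) (j : ℕ) (g : ℕ → ℝ) (hg : g T = 0) :
    ∑ i ∈ Finset.range T, quadrantFlow (i + 1) j * (g (i + 1) - g i) =
      ∑ i ∈ Finset.range T, (quadrantFlow i j - quadrantFlow (i + 1) j) * g i := by
  have h1 := Finset.sum_range_succ (fun i => quadrantFlow i j * g i) T
  rw [Finset.sum_range_succ', hg] at h1
  have h0 : quadrantFlow 0 j = 0 := by simp [quadrantFlow]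
  simp only [h0, zero_mul, mul_zero, add_zero] at h1
  simp only [mul_sub, sub_mul, Finset.sum_sub_distrib, h1]

/-- A function on the quadrant that vanishes outside a box is recovered at the origin from its
gradient. -/
theorem eq_neg_sum_quadrantFlow {T : ℕ} (hT : 0 < T) (G : ℕ → ℕ → ℝ)
    (hG : ∀ i j, T ≤ i ∨ T ≤ j → G i j = 0) :
    G 0 0 = -∑ i ∈ Finset.range T, ∑ j ∈ Finset.range T,
      (quadrantFlow (i + 1) j * (G (i + 1) j - G i j) +
        quadrantFlow (j + 1) i * (G i (j + 1) - G i j)) := by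
  have h1 : ∑ i ∈ Finset.range T, ∑ j ∈ Finset.range T,
      quadrantFlow (i + 1) j * (G (i + 1) j - G i j) = ∑ i ∈ Finset.range T,
        ∑ j ∈ Finset.range T, (quadrantFlow i j - quadrantFlow (i + 1) j) * G i j := by
    rw [Finset.sum_comm, Finset.sum_comm (f := fun i j => _ * G i j)]
    exact Finset.sum_congr rfl fun j _ =>
      sum_quadrantFlow_mul_sub T j (fun i => G i j) (hG T j (Or.inl le_rfl))
  have h2 : ∑ i ∈ Finset.range T, ∑ j ∈ Finset.range T,
      quadrantFlow (j + 1) i * (G i (j + 1) - G i j) = ∑ i ∈ Finset.range T,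
        ∑ j ∈ Finset.range T, (quadrantFlow j i - quadrantFlow (j + 1) i) * G i j :=
    Finset.sum_congr rfl fun i _ => sum_quadrantFlow_mul_sub T i (G i) (hG i T (Or.inr le_rfl))
  simp only [Finset.sum_add_distrib]
  rw [h1, h2]
  simp only [← Finset.sum_add_distrib]
  have h3 : ∀ i j, (quadrantFlow i j - quadrantFlow (i + 1) j) * G i j +
      (quadrantFlow j i - quadrantFlow (j + 1) i) * G i j =
        if i = 0 then (if j = 0 then -G i j else 0) else 0 := by
    intro i j
    rw [← add_mul, show quadrantFlow i j - quadrantFlow (i + 1) j +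
      (quadrantFlow j i - quadrantFlow (j + 1) i) = quadrantFlow i j + quadrantFlow j i -
        quadrantFlow (i + 1) j - quadrantFlow (j + 1) i by ring, quadrantFlow_divergence]
    by_cases hi : i = 0 <;> by_cases hj : j = 0 <;> simp [hi, hj]
  simp only [h3]
  simp [hT]

theorem sum_range_ite_le (T v : ℕ) (k : ℕ → ℝ) (hk : ∀ p, T ≤ p → k p = 0) :
    ∑ p ∈ Finset.range T, (if v ≤ p then k p else 0) = ∑ i ∈ Finset.range T, k (v + i) := by
  have h1 : ∑ p ∈ Finset.range T, (if v ≤ p then k p else 0) =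
      ∑ p ∈ Finset.range (v + T), (if v ≤ p then k p else 0) := by
    refine Finset.sum_subset (Finset.range_mono (by omega)) fun p _ hp => ?_
    rw [hk p (by simpa using hp), ite_self]
  rw [h1, Finset.sum_range_add, Finset.sum_eq_zero, zero_add]
  · simp
  · intro p hp
    rw [if_neg (by simpa using hp)]

theorem sum_range_ite_sub_le (T v : ℕ) (k : ℕ → ℝ) (hk : ∀ p, 0 ≤ k p) :
    ∑ p ∈ Finset.range T, (if v ≤ p then k (p - v) else 0) ≤ ∑ i ∈ Finset.range T, k i := by
  have h1 : ∑ p ∈ Finset.range T, (if v ≤ p then k (p - v) else 0) ≤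
      ∑ p ∈ Finset.range (v + T), (if v ≤ p then k (p - v) else 0) := by
    refine Finset.sum_le_sum_of_subset_of_nonneg (Finset.range_mono (by omega)) fun p _ _ => ?_
    split_ifs
    · exact hk _
    · exact le_rfl
  refine h1.trans (le_of_eq ?_)
  rw [Finset.sum_range_add, Finset.sum_eq_zero, zero_add]
  · simp
  · intro p hp
    rw [if_neg (by simpa using hp)]

/-- The translate of the quadrant flow that starts at `(v, w)`, as a function of the edges: the
edge `(p, q, true)` joins `(p, q)` to `(p + 1, q)`, and `(p, q, false)` joins it to
`(p, q + 1)`. -/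
def shiftedFlow (v w p q : ℕ) (b : Bool) : ℝ :=
  if v ≤ p then if w ≤ q then
    if b then quadrantFlow (p - v + 1) (q - w) else quadrantFlow (q - w + 1) (p - v)
  else 0 else 0

/-- The increment of `G` along an edge. -/
def edgeIncrement (G : ℕ → ℕ → ℝ) (p q : ℕ) (b : Bool) : ℝ :=
  if b then G (p + 1) q - G p q else G p (q + 1) - G p q

theorem eq_neg_sum_shiftedFlow {T : ℕ} (hT : 0 < T) (G : ℕ → ℕ → ℝ)
    (hG : ∀ i j, T ≤ i ∨ T ≤ j → G i j = 0) (v w : ℕ) :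
    G v w = -∑ p ∈ Finset.range T, ∑ q ∈ Finset.range T, ∑ b,
      edgeIncrement G p q b * shiftedFlow v w p q b := by
  have h := eq_neg_sum_quadrantFlow hT (fun i j => G (v + i) (w + j))
    (fun i j h => hG _ _ (h.imp (by omega) (by omega)))
  simp only [add_zero] at h
  rw [h]
  congr 1
  set k : ℕ → ℕ → ℝ := fun p q => quadrantFlow (p - v + 1) (q - w) * (G (p + 1) q - G p q) +
    quadrantFlow (q - w + 1) (p - v) * (G p (q + 1) - G p q)
  have hk : ∀ p q, T ≤ p ∨ T ≤ q → k p q = 0 := by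
    intro p q h
    simp only [k]
    rw [hG p q h, hG (p + 1) q (h.imp (by omega) id), hG p (q + 1) (h.imp id (by omega))]
    simp
  have h1 : ∀ p q, ∑ b, edgeIncrement G p q b * shiftedFlow v w p q b =
      if v ≤ p then if w ≤ q then k p q else 0 else 0 := by
    intro p q
    by_cases hv : v ≤ p <;> by_cases hw : w ≤ q <;>
      simp [edgeIncrement, shiftedFlow, k, hv, hw, mul_comm]
  simp only [h1]
  have h2 : ∀ p, ∑ q ∈ Finset.range T, (if v ≤ p then if w ≤ q then k p q else 0 else 0) =
      if v ≤ p then ∑ j ∈ Finset.range T, k p (w + j) else 0 := by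
    intro p
    split_ifs
    · exact sum_range_ite_le T w (k p) fun q hq => hk p q (Or.inr hq)
    · simp
  simp only [h2]
  rw [sum_range_ite_le T v _ fun p hp => Finset.sum_eq_zero fun j _ => hk p _ (Or.inl hp)]
  simp [k, add_assoc]

/-- Telescoping of `1 / m² ≤ 2 / m - 2 / (m + 1)`, valid for `m ≥ 1`. -/
theorem sum_inv_sq_le (i T : ℕ) :
    ∑ j ∈ Finset.range T, (1 / ((i : ℝ) + j + 1)) ^ 2 ≤
      2 / ((i : ℝ) + 1) - 2 / (i + T + 1) := by
  induction T with
  | zero => simp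
  | succ T ih =>
    rw [Finset.sum_range_succ]
    have hm : (1 : ℝ) ≤ i + T + 1 := by
      have : (0 : ℝ) ≤ i + T := by positivity
      linarith
    push_cast
    have : (1 / ((i : ℝ) + T + 1)) ^ 2 ≤ 2 / (i + T + 1) - 2 / (i + (T + 1) + 1) := by
      rw [show (i : ℝ) + (T + 1) + 1 = (i + T + 1) + 1 by ring]
      generalize (i : ℝ) + T + 1 = m at hm
      rw [div_sub_div _ _ (by positivity) (by positivity), div_pow,
        div_le_div_iff₀ (by positivity) (by positivity)]
      nlinarith
    linarith

/-- The energy of the flow is logarithmic in the size of the box. -/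
theorem sum_shiftedFlow_sq_le (T v w : ℕ) :
    ∑ p ∈ Finset.range T, ∑ q ∈ Finset.range T, ∑ b, shiftedFlow v w p q b ^ 2 ≤
      4 * (1 + Real.log T) := by
  set k : ℕ → ℕ → ℝ := fun i j => 2 * (1 / ((i : ℝ) + j + 1)) ^ 2
  have hk : ∀ i j, 0 ≤ k i j := fun i j => by positivity
  have h1 : ∀ p q, ∑ b, shiftedFlow v w p q b ^ 2 ≤
      if v ≤ p then if w ≤ q then k (p - v) (q - w) else 0 else 0 := by
    intro p q
    by_cases hv : v ≤ p <;> by_cases hw : w ≤ q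
    · have e1 := pow_le_pow_left₀ (quadrantFlow_nonneg _ _) (quadrantFlow_succ_le (p - v) (q - w)) 2
      have e2 := pow_le_pow_left₀ (quadrantFlow_nonneg _ _) (quadrantFlow_succ_le (q - w) (p - v)) 2
      rw [add_comm ((q - w : ℕ) : ℝ)] at e2
      simp only [Fintype.sum_bool, shiftedFlow, k, if_pos hv, if_pos hw, if_true,
        Bool.false_eq_true, if_false]
      linarith
    all_goals simp [shiftedFlow, hv, hw]
  calc _ ≤ ∑ p ∈ Finset.range T, ∑ q ∈ Finset.range T,
        (if v ≤ p then if w ≤ q then k (p - v) (q - w) else 0 else 0) :=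
        Finset.sum_le_sum fun p _ => Finset.sum_le_sum fun q _ => h1 p q
    _ ≤ ∑ p ∈ Finset.range T, (if v ≤ p then ∑ j ∈ Finset.range T, k (p - v) j else 0) := by
        refine Finset.sum_le_sum fun p _ => ?_
        split_ifs
        · exact sum_range_ite_sub_le T w (k (p - v)) (hk _)
        · simp
    _ ≤ ∑ i ∈ Finset.range T, ∑ j ∈ Finset.range T, k i j :=
        sum_range_ite_sub_le T v (fun i => ∑ j ∈ Finset.range T, k i j)
          fun i => Finset.sum_nonneg fun j _ => hk i j
    -- Each row contributes `O(1 / (i + 1))`; the harmonic sum over rows is the source of the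
    -- logarithm.
    _ ≤ ∑ i ∈ Finset.range T, 4 * ((i : ℝ) + 1)⁻¹ := by
        refine Finset.sum_le_sum fun i _ => ?_
        simp only [k, ← Finset.mul_sum]
        have := sum_inv_sq_le i T
        have h0 : (0 : ℝ) ≤ 2 / (i + T + 1) := by positivity
        rw [div_eq_mul_inv] at this
        linarith
    _ ≤ 4 * (1 + Real.log T) := by
        rw [← Finset.mul_sum]
        have := harmonic_le_one_add_log T
        simp only [harmonic] at this
        push_cast at this
        linarith

end PlanarFlow

/-! ### The planar Rademacher bound -/

section PlanarRademacher

/-- McShane extension along a map, preserving a uniform bound. -/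
theorem exists_lipschitz_extension_along {X Y : Type*} [PseudoMetricSpace Y] (s : Set X)
    (u : X → Y) (f : X → ℝ) {Λ B : ℝ} (hΛ : 0 ≤ Λ) (hB : 0 ≤ B)
    (hf : ∀ x ∈ s, ∀ y ∈ s, |f x - f y| ≤ Λ * dist (u x) (u y)) (hfB : ∀ x, |f x| ≤ B) :
    ∃ g : Y → ℝ, (∀ y z, |g y - g z| ≤ Λ * dist y z) ∧ (∀ y, |g y| ≤ B) ∧
      ∀ x ∈ s, g (u x) = f x := by
  classical
  have hsel : ∀ y : Y, ∃ t : ℝ, ∀ x ∈ s, u x = y → t = f x := by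
    intro y
    by_cases hy : ∃ x ∈ s, u x = y
    · obtain ⟨x, hx, rfl⟩ := hy
      refine ⟨f x, fun x' hx' h => ?_⟩
      -- Equal coordinates force equal values, so `f` descends to the image of `u`.
      have := hf x hx x' hx'
      rw [h, dist_self, mul_zero] at this
      exact sub_eq_zero.1 (abs_eq_zero.1 (le_antisymm this (abs_nonneg _)))
    · exact ⟨0, fun x hx h => (hy ⟨x, hx, h⟩).elim⟩
  choose h hh using hsel
  have hlip : LipschitzOnWith Λ.toNNReal h (u '' s) := by
    refine LipschitzOnWith.of_dist_le_mul ?_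
    rintro _ ⟨x, hx, rfl⟩ _ ⟨y, hy, rfl⟩
    rw [hh _ x hx rfl, hh _ y hy rfl, Real.dist_eq, Real.coe_toNNReal _ hΛ]
    exact hf x hx y hy
  obtain ⟨g, hg, hgh⟩ := hlip.extend_real
  refine ⟨fun y => max (-B) (min B (g y)), fun y z => ?_, fun y => ?_, fun x hx => ?_⟩
  · have := ((hg.const_min B).const_max (-B)).dist_le_mul y z
    rwa [Real.dist_eq, Real.coe_toNNReal _ hΛ] at this
  · rw [abs_le]
    exact ⟨le_max_left _ _, max_le (by linarith) (min_le_left _ _)⟩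
  · have e : g (u x) = f x := by rw [← hgh (mem_image_of_mem _ hx), hh _ x hx rfl]
    have := abs_le.1 (hfB x)
    simp only [e]
    rw [min_eq_right this.2, max_eq_right this.1]

/-- A cutoff on `ℕ`, equal to one up to `2 N` and to zero from `4 N` on. -/
def gridCutoff (N k : ℕ) : ℝ := max 0 (min 1 ((4 * N - k) / (2 * N)))

theorem gridCutoff_of_le {N k : ℕ} (hN : 0 < N) (h : k ≤ 2 * N) : gridCutoff N k = 1 := by
  have hN' : (0 : ℝ) < N := by exact_mod_cast hN
  have h' : (k : ℝ) ≤ 2 * N := by exact_mod_cast h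
  have : 1 ≤ (4 * N - k : ℝ) / (2 * N) := by rw [le_div_iff₀ (by positivity)]; linarith
  simp [gridCutoff, min_eq_left this]

theorem gridCutoff_of_ge {N k : ℕ} (h : 4 * N ≤ k) : gridCutoff N k = 0 := by
  have h' : 4 * (N : ℝ) ≤ k := by exact_mod_cast h
  have : (4 * N - k : ℝ) / (2 * N) ≤ 0 := div_nonpos_of_nonpos_of_nonneg (by linarith) (by simp)
  exact max_eq_left ((min_le_right _ _).trans this)

theorem gridCutoff_mem (N k : ℕ) : 0 ≤ gridCutoff N k ∧ gridCutoff N k ≤ 1 :=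
  ⟨le_max_left _ _, max_le zero_le_one (min_le_left _ _)⟩

theorem abs_gridCutoff_succ_sub_le {N : ℕ} (hN : 0 < N) (k : ℕ) :
    |gridCutoff N (k + 1) - gridCutoff N k| ≤ 1 / N := by
  have hN' : (0 : ℝ) < N := by exact_mod_cast hN
  have h : LipschitzWith 1 fun t : ℝ => max 0 (min 1 t) :=
    (LipschitzWith.id.const_min 1).const_max 0
  have := h.dist_le_mul ((4 * N - (k + 1 : ℕ)) / (2 * N) : ℝ) ((4 * N - k) / (2 * N) : ℝ)
  rw [Real.dist_eq, Real.dist_eq, NNReal.coe_one, one_mul] at this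
  refine this.trans ?_
  rw [← sub_div, abs_div, abs_of_pos (by positivity : (0 : ℝ) < 2 * N),
    div_le_div_iff₀ (by positivity) hN']
  push_cast
  rw [show (4 * N - (k + 1) - (4 * N - k) : ℝ) = -1 by ring, abs_neg, abs_one]
  linarith

/-- Restriction to a grid of mesh `1 / N`, with a cutoff, of a function on the plane. -/
def gridFunction (N : ℕ) (g : (Fin 2 → ℝ) → ℝ) (i j : ℕ) : ℝ :=
  gridCutoff N (i + j) * g ![(i : ℝ) / N, (j : ℝ) / N]

theorem abs_edgeIncrement_gridFunction_le {N : ℕ} (hN : 0 < N) {g : (Fin 2 → ℝ) → ℝ} {Λ B : ℝ}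
    (hΛ : 0 ≤ Λ) (hg : ∀ y z, |g y - g z| ≤ Λ * dist y z) (hgB : ∀ y, |g y| ≤ B) (p q : ℕ)
    (b : Bool) : |edgeIncrement (gridFunction N g) p q b| ≤ (Λ + B) / N := by
  have hN' : (0 : ℝ) < N := by exact_mod_cast hN
  have key : ∀ (k : ℕ) (y z : Fin 2 → ℝ), dist y z ≤ 1 / N →
      |gridCutoff N (k + 1) * g y - gridCutoff N k * g z| ≤ (Λ + B) / N := by
    intro k y z hyz
    -- Discrete product rule: the slope of `g` gives `Λ / N`, that of the cutoff gives `B / N`.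
    have e : gridCutoff N (k + 1) * g y - gridCutoff N k * g z =
        gridCutoff N (k + 1) * (g y - g z) + (gridCutoff N (k + 1) - gridCutoff N k) * g z := by
      ring
    rw [e]
    refine (abs_add_le _ _).trans ?_
    rw [abs_mul, abs_mul, abs_of_nonneg (gridCutoff_mem N (k + 1)).1]
    have h1 : gridCutoff N (k + 1) * |g y - g z| ≤ 1 * (Λ * (1 / N)) :=
      mul_le_mul (gridCutoff_mem N (k + 1)).2 ((hg y z).trans (by gcongr)) (abs_nonneg _) zero_le_one
    have h2 : |gridCutoff N (k + 1) - gridCutoff N k| * |g z| ≤ 1 / N * B :=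
      mul_le_mul (abs_gridCutoff_succ_sub_le hN k) (hgB z) (abs_nonneg _) (by positivity)
    calc _ ≤ 1 * (Λ * (1 / N)) + 1 / N * B := add_le_add h1 h2
      _ = _ := by field_simp
  cases b with
  | true =>
    simp only [edgeIncrement, gridFunction, if_true]
    rw [show p + 1 + q = p + q + 1 by ring]
    refine key _ _ _ ((dist_pi_le_iff (by positivity)).2 fun i => ?_)
    fin_cases i
    · simp [add_div]
    · simp
  | false =>
    simp only [edgeIncrement, gridFunction, Bool.false_eq_true, if_false]
    rw [show p + (q + 1) = p + q + 1 by ring]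
    refine key _ _ _ ((dist_pi_le_iff (by positivity)).2 fun i => ?_)
    fin_cases i
    · simp
    · simp [add_div]

/-- On a space made of finitely many pieces with planar coordinates whose inverse is Lipschitz,
the empirical Rademacher complexity of bounded Lipschitz functions is `O(√(log n / n))` (choose
`N` of order `√n`). -/
theorem empiricalRademacher_le_planar {X : Type*} [MetricSpace X] {P : ℕ} {K L B : ℝ}
    (hK : 0 ≤ K) (hL : 0 ≤ L) (hB : 0 ≤ B) (a : X → Fin P) (u : X → Fin 2 → ℝ)
    (hu : ∀ x i, 0 ≤ u x i ∧ u x i < 1)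
    (hau : ∀ x y, a x = a y → dist x y ≤ K * dist (u x) (u y))
    {F : Set (X → ℝ)} (hF : F.Nonempty) (hFL : F ⊆ lipschitzClass X L B)
    {n : ℕ} (hn : 1 ≤ n) (x : Fin n → X) {N : ℕ} (hN : 0 < N) :
    empiricalRademacher F x ≤
      L * K / N + √(32 * P) * (L * K + B) * √(4 * (1 + Real.log (4 * N : ℕ)) / n) := by
  classical
  have hN' : (0 : ℝ) < N := by exact_mod_cast hN
  set T := 4 * N
  set v : X → Fin 2 → ℕ := fun x i => ⌊(N : ℝ) * u x i⌋₊
  have hvle : ∀ x i, (v x i : ℝ) ≤ N * u x i := fun x i =>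
    Nat.floor_le (mul_nonneg hN'.le (hu x i).1)
  have hvlt : ∀ x i, v x i < N := fun x i => by
    have := (hvle x i).trans_lt (mul_lt_of_lt_one_right hN' (hu x i).2)
    exact_mod_cast this
  have hudist : ∀ x, dist (u x) ![(v x 0 : ℝ) / N, (v x 1 : ℝ) / N] ≤ 1 / N := by
    intro x
    have key : ∀ i, |u x i - (v x i : ℝ) / N| ≤ 1 / N := by
      intro i
      have h1 := hvle x i
      have h2 := (Nat.lt_floor_add_one ((N : ℝ) * u x i)).le
      have e : u x i - (v x i : ℝ) / N = (N * u x i - v x i) / N := by field_simp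
      rw [e, abs_div, abs_of_pos hN']
      refine div_le_div_of_nonneg_right ?_ hN'.le
      rw [abs_le]
      constructor <;> linarith
    refine (dist_pi_le_iff (by positivity)).2 fun i => ?_
    fin_cases i
    · exact key 0
    · exact key 1
  -- The features of `x` are the edge values of the flow issuing from the lower corner of its grid
  -- cell, placed in the block of its piece.
  refine empiricalRademacher_le_of_features (ι := Fin P × Fin T × Fin T × Bool) hF hn x
    (fun x e => if e.1 = a x then shiftedFlow (v x 0) (v x 1) e.2.1 e.2.2.1 e.2.2.2 else 0)
    (by positivity) (fun x => ?_) fun f hf => ?_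
  · have := sum_shiftedFlow_sq_le T (v x 0) (v x 1)
    simp only [Finset.sum_range] at this
    simpa [Fintype.sum_prod_type, ite_pow, Finset.sum_ite_irrel] using this
  · obtain ⟨hfL, hfB⟩ := hFL hf
    have hext : ∀ t : Fin P, ∃ g : (Fin 2 → ℝ) → ℝ, (∀ y z, |g y - g z| ≤ L * K * dist y z) ∧
        (∀ y, |g y| ≤ B) ∧ ∀ x ∈ {x | a x = t}, g (u x) = f x := fun t =>
      exists_lipschitz_extension_along {x | a x = t} u f (by positivity) hB
        (fun x hx y hy => (hfL x y).trans (by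
          rw [mul_assoc]
          exact mul_le_mul_of_nonneg_left (hau x y (hx.trans hy.symm)) hL)) hfB
    choose g hgL hgB hgf using hext
    refine ⟨fun e => -edgeIncrement (gridFunction N (g e.1)) e.2.1 e.2.2.1 e.2.2.2, ?_,
      fun x => ?_⟩
    -- There are `2 P (4 N)² = 32 P N²` edges, each with increment at most `(L K + B) / N`; the
    -- factors `N²` cancel.
    · calc _ ≤ ∑ _e : Fin P × Fin T × Fin T × Bool, ((L * K + B) / N) ^ 2 := by
            refine Finset.sum_le_sum fun e _ => ?_
            rw [neg_sq]
            have := abs_edgeIncrement_gridFunction_le hN (by positivity) (hgL e.1) (hgB e.1)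
              e.2.1 e.2.2.1 e.2.2.2
            exact sq_le_sq' (abs_le.1 this).1 (abs_le.1 this).2
        _ = _ := by
            rw [Finset.sum_const, Finset.card_univ, mul_pow, Real.sq_sqrt (by positivity)]
            simp only [Fintype.card_prod, Fintype.card_fin, Fintype.card_bool, nsmul_eq_mul, T]
            push_cast
            field_simp
            ring
    · have h1 := eq_neg_sum_shiftedFlow (T := T) (by omega) (gridFunction N (g (a x)))
        (fun i j h => by rw [gridFunction, gridCutoff_of_ge (by omega), zero_mul]) (v x 0) (v x 1)
      have h2 : ∑ e : Fin P × Fin T × Fin T × Bool,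
          -edgeIncrement (gridFunction N (g e.1)) e.2.1 e.2.2.1 e.2.2.2 *
            (if e.1 = a x then shiftedFlow (v x 0) (v x 1) e.2.1 e.2.2.1 e.2.2.2 else 0) =
          gridFunction N (g (a x)) (v x 0) (v x 1) := by
        rw [h1]
        simp [Fintype.sum_prod_type, Finset.sum_ite_irrel, Finset.sum_range]
      -- Cell corners have coordinates below `N`, so their sum stays where the cutoff is `1`.
      rw [h2, gridFunction, gridCutoff_of_le hN (by have := hvlt x 0; have := hvlt x 1; omega),
        one_mul, ← hgf (a x) x rfl]
      refine (hgL _ _ _).trans ?_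
      calc _ ≤ L * K * (1 / N) := by gcongr; exact hudist x
        _ = _ := by ring

end PlanarRademacher

/-! ### Integrability and passage to the expectation -/

section Integrability

theorem bddAbove_range_rademacherAverage {X : Type*} {F : Set (X → ℝ)} {B : ℝ}
    (hFB : ∀ f ∈ F, ∀ x, |f x| ≤ B) {n : ℕ} (σ : Fin n → ℤˣ) (x : Fin n → X) :
    BddAbove (range fun f : F => (1 / (n : ℝ)) * ∑ i, ((σ i : ℤ) : ℝ) * f.1 (x i)) := by
  refine ⟨1 / n * (n * B), ?_⟩
  rintro _ ⟨f, rfl⟩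
  exact mul_le_mul_of_nonneg_left (sum_sign_mul_le σ fun i => hFB f.1 f.2 (x i)) (by positivity)

/-- For fixed signs each average is `L`-Lipschitz in the sample for the sup distance, uniformly in
`f`; hence so is the supremum, even over an uncountable class. -/
theorem continuous_empiricalRademacher {X : Type*} [MetricSpace X] {L B : ℝ} (hL : 0 ≤ L)
    {F : Set (X → ℝ)} (hF : F.Nonempty) (hFL : F ⊆ lipschitzClass X L B) {n : ℕ} (hn : 1 ≤ n) :
    Continuous fun x : Fin n → X => empiricalRademacher F x := by
  have hn' : (0 : ℝ) < n := by exact_mod_cast hn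
  have : Nonempty F := hF.to_subtype
  simp only [empiricalRademacher]
  refine continuous_const.mul (continuous_finsetSum _ fun σ _ => ?_)
  refine LipschitzWith.continuous (K := L.toNNReal) (LipschitzWith.of_le_add_mul _ fun x y => ?_)
  refine ciSup_le fun f => ?_
  have h1 := le_ciSup (bddAbove_range_rademacherAverage (fun f hf => (hFL hf).2) σ y) f
  have h2 := sum_sign_mul_le σ (b := fun i => f.1 (x i) - f.1 (y i)) (δ := L * dist x y)
    fun i => ((hFL f.2).1 _ _).trans
      (mul_le_mul_of_nonneg_left (dist_le_pi_dist x y i) hL)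
  have h3 : (1 / (n : ℝ)) * ∑ i, ((σ i : ℤ) : ℝ) * f.1 (x i) =
      (1 / (n : ℝ)) * ∑ i, ((σ i : ℤ) : ℝ) * f.1 (y i) +
        (1 / (n : ℝ)) * ∑ i, ((σ i : ℤ) : ℝ) * (f.1 (x i) - f.1 (y i)) := by
    rw [← mul_add, ← Finset.sum_add_distrib]
    congr 1
    exact Finset.sum_congr rfl fun i _ => by ring
  have h4 : (1 / (n : ℝ)) * ∑ i, ((σ i : ℤ) : ℝ) * (f.1 (x i) - f.1 (y i)) ≤ L * dist x y := by
    rw [one_div, inv_mul_le_iff₀ hn']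
    exact h2
  rw [Real.coe_toNNReal _ hL, h3]
  exact add_le_add h1 h4

theorem integrable_empiricalRademacher {X : Type*} [MetricSpace X] [CompactSpace X]
    [MeasurableSpace X] [BorelSpace X] (μ : Measure X) [IsProbabilityMeasure μ] {L B : ℝ}
    (hL : 0 ≤ L) {F : Set (X → ℝ)} (hF : F.Nonempty) (hFL : F ⊆ lipschitzClass X L B) {n : ℕ}
    (hn : 1 ≤ n) :
    Integrable (fun x : Fin n → X => empiricalRademacher F x) (Measure.pi fun _ => μ) :=
  (continuous_empiricalRademacher hL hF hFL hn).integrable_of_hasCompactSupport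
    (HasCompactSupport.of_compactSpace _)

theorem rademacher_le {X : Type*} [MetricSpace X] [CompactSpace X]
    [MeasurableSpace X] [BorelSpace X] (μ : Measure X) [IsProbabilityMeasure μ] {L B : ℝ}
    (hL : 0 ≤ L) {F : Set (X → ℝ)} (hF : F.Nonempty) (hFL : F ⊆ lipschitzClass X L B) {n : ℕ}
    (hn : 1 ≤ n) {c : ℝ} (hc : ∀ x : Fin n → X, empiricalRademacher F x ≤ c) :
    rademacher μ n F ≤ c := by
  have := integral_mono (integrable_empiricalRademacher μ hL hF hFL hn) (integrable_const c) hc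
  simpa [rademacher] using this

end Integrability

/-! ### Entropy of bounded Lipschitz classes -/

section Entropy

theorem supCoveringNumber_lipschitz_ne_top {X : Type*} [MetricSpace X] [CompactSpace X] {L B : ℝ}
    (hL : 0 < L) {F : Set (X → ℝ)} (hFL : F ⊆ lipschitzClass X L B) {ε : ℝ} (hε : 0 < ε) :
    supCoveringNumber F ε ≠ ⊤ := by
  obtain ⟨t, -, ht⟩ := isCompact_univ.elim_nhds_subcover (fun p : X => ball p (ε / (4 * L)))
    (fun p _ => ball_mem_nhds _ (by positivity))
  have hcov : ∀ x : X, ∃ p : t, dist x p < ε / (4 * L) := by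
    intro x
    obtain ⟨p, hp, hx⟩ := mem_iUnion₂.1 (ht (mem_univ x))
    exact ⟨⟨p, hp⟩, hx⟩
  choose c hc using hcov
  refine ((supCoveringNumber_le_of_partition hε (fun f hf => (hFL hf).2) c
    fun f hf x y hxy => ((hFL hf).1 x y).trans ?_).trans_lt (ENat.natCast_lt_top _)).ne
  have h1 := hc x
  have h2 := hc y
  rw [← hxy] at h2
  have h3 := dist_triangle_right x y (c x)
  have h4 : dist x y ≤ ε / (4 * L) + ε / (4 * L) := by linarith
  calc L * dist x y ≤ L * (ε / (4 * L) + ε / (4 * L)) := by gcongr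
    _ = ε / 2 := by field_simp; ring

/-- The entropy at scale `ε` of bounded Lipschitz functions on a `d`-dimensional space is
`O(ε ^ (-d) log (1 / ε))`. -/
theorem log_supCoveringNumber_le {X : Type*} [MetricSpace X] {d P : ℕ} {K L B : ℝ}
    (hK : 0 < K) (hL : 0 < L) (hB : 0 < B) (a : X → Fin P) (u : X → Fin d → ℝ)
    (hu : ∀ x i, 0 ≤ u x i ∧ u x i < 1)
    (hau : ∀ x y, a x = a y → dist x y ≤ K * dist (u x) (u y))
    {F : Set (X → ℝ)} (hF : F.Nonempty) (hFL : F ⊆ lipschitzClass X L B) {ε : ℝ} (hε : 0 < ε)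
    (hεB : ε ≤ B) :
    Real.log (supCoveringNumber F ε).toNat ≤
      P * ((2 * L * K + B) / ε) ^ d * Real.log (5 * B / ε) := by
  -- On a coordinate cell of side `1 / m` a function of the class varies by at most `L K / m ≤ ε /
  -- 2`.
  set m := ⌈2 * L * K / ε⌉₊
  have hm0 : 0 < m := Nat.ceil_pos.2 (by positivity)
  have hm0' : (0 : ℝ) < m := by exact_mod_cast hm0
  have hm1 : 2 * L * K / ε ≤ m := Nat.le_ceil _
  have h1B : 1 ≤ B / ε := (one_le_div hε).2 hεB
  have hm2 : (m : ℝ) ≤ (2 * L * K + B) / ε := by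
    rw [add_div]
    exact (Nat.ceil_lt_add_one (by positivity)).le.trans (by linarith)
  have hlt : ∀ x i, ⌊(m : ℝ) * u x i⌋₊ < m := fun x i => by
    rw [Nat.floor_lt (mul_nonneg hm0'.le (hu x i).1)]
    exact mul_lt_of_lt_one_right hm0' (hu x i).2
  have hcov := supCoveringNumber_le_of_partition hε (fun f hf => (hFL hf).2)
    (fun x => ((a x, fun i => ⟨_, hlt x i⟩) : Fin P × (Fin d → Fin m))) fun f hf x y hxy => by
      simp only [Prod.mk.injEq] at hxy
      have hd : dist (u x) (u y) ≤ 1 / m := by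
        refine (dist_pi_le_iff (by positivity)).2 fun i => ?_
        have hi : ⌊(m : ℝ) * u x i⌋₊ = ⌊(m : ℝ) * u y i⌋₊ :=
          congrArg Fin.val (congrFun hxy.2 i)
        have a1 := Nat.floor_le (mul_nonneg hm0'.le (hu x i).1)
        have a2 := Nat.lt_floor_add_one ((m : ℝ) * u x i)
        have b1 := Nat.floor_le (mul_nonneg hm0'.le (hu y i).1)
        have b2 := Nat.lt_floor_add_one ((m : ℝ) * u y i)
        rw [hi] at a1 a2
        rw [Real.dist_eq, le_div_iff₀ hm0', mul_comm, ← abs_of_pos hm0', ← abs_mul, abs_le]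
        constructor <;> linarith
      calc |f x - f y| ≤ L * dist x y := (hFL hf).1 x y
        _ ≤ L * (K * (1 / m)) := by
          gcongr
          exact (hau x y hxy.1).trans (by gcongr)
        _ ≤ ε / 2 := by
          rw [div_le_iff₀ hε] at hm1
          rw [mul_one_div, mul_div_assoc', div_le_div_iff₀ hm0' two_pos]
          linarith
  have hne : supCoveringNumber F ε ≠ ⊤ := (hcov.trans_lt (ENat.natCast_lt_top _)).ne
  have hN := ENat.toNat_le_toNat hcov (ENat.natCast_ne_top _)
  rw [ENat.toNat_natCast] at hN
  have hpos := one_le_toNat_supCoveringNumber hF hne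
  have hcard : Fintype.card (Fin P × (Fin d → Fin m)) = P * m ^ d := by simp
  rw [hcard] at hN
  have hlog := Real.log_le_log (by exact_mod_cast hpos)
    (show ((supCoveringNumber F ε).toNat : ℝ) ≤ ((2 * ⌈B / ε⌉₊ + 1 : ℕ) : ℝ) ^ (P * m ^ d) by
      exact_mod_cast hN)
  rw [Real.log_pow] at hlog
  -- The ceiling gives `2 B / ε + 3`, and `1 ≤ B / ε`.
  have h5 : ((2 * ⌈B / ε⌉₊ + 1 : ℕ) : ℝ) ≤ 5 * B / ε := by
    have := (Nat.ceil_lt_add_one (show 0 ≤ B / ε by positivity)).le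
    push_cast
    rw [mul_div_assoc]
    linarith
  have h6 : Real.log ((2 * ⌈B / ε⌉₊ + 1 : ℕ) : ℝ) ≤ Real.log (5 * B / ε) :=
    Real.log_le_log (by positivity) h5
  refine hlog.trans ?_
  push_cast at h6 ⊢
  have h7 : 0 ≤ Real.log (2 * (⌈B / ε⌉₊ : ℝ) + 1) := Real.log_nonneg (by
    have : (0 : ℝ) ≤ ⌈B / ε⌉₊ := Nat.cast_nonneg _
    linarith)
  gcongr

end Entropy

/-! ### Rates in `n` -/

section Rate

/-- `hLn` gives `log n ≤ 4 log (L √n)`; the factor `d ≥ 1` and the nonnegative penalty only enlarge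
the right side, and `2 = √4`. -/
theorem sqrt_log_div_le_curvatureRate {d : ℕ} (hd : 1 ≤ d) (κ : ℝ) {L : ℝ} (hL : 0 < L) {n : ℕ}
    (hn : 1 ≤ n) (hLn : -4 * Real.log L ≤ Real.log n) :
    √(Real.log n) / (n : ℝ) ^ (1 / (d : ℝ)) ≤ 2 * curvatureRate d κ L n := by
  have hn' : (0 : ℝ) < n := by exact_mod_cast hn
  rw [curvatureRate, ← mul_div_assoc]
  refine div_le_div_of_nonneg_right ?_ (by positivity)
  rw [show (2 : ℝ) = √(2 ^ 2) from (Real.sqrt_sq two_pos.le).symm, ← Real.sqrt_mul (by positivity)]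
  refine Real.sqrt_le_sqrt ?_
  have h1 : Real.log (L * √n) = Real.log L + Real.log n / 2 := by
    rw [Real.log_mul hL.ne' (Real.sqrt_pos.2 hn').ne', Real.log_sqrt hn'.le]
  have h2 : 0 ≤ curvaturePenalty κ L := by unfold curvaturePenalty; positivity
  have h3 : (1 : ℝ) ≤ d := by exact_mod_cast hd
  have h4 : 0 ≤ Real.log n := Real.log_nonneg (by exact_mod_cast hn)
  have h5 : Real.log n / 4 ≤ Real.log (L * √n) := by rw [h1]; linarith
  have h6 : Real.log n / 4 ≤ d * Real.log (L * √n) := by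
    refine h5.trans (le_mul_of_one_le_left (by linarith) h3)
  linarith

/-- The factor `2` bounds `1 / (d / 2 - 1)`, which is where `d ≥ 3` enters. -/
theorem integral_rpow_neg_half_le {d : ℕ} (hd : 3 ≤ d) {α B : ℝ} (hα : 0 < α) (hαB : α ≤ B) :
    ∫ ε in α..B, ε ^ (-((d : ℝ) / 2)) ≤ 2 * α ^ (1 - (d : ℝ) / 2) := by
  have hd' : (3 : ℝ) ≤ d := by exact_mod_cast hd
  rw [integral_rpow (Or.inr ⟨by linarith, by rw [uIcc_of_le hαB]; exact fun h => h.1.not_gt hα⟩),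
    show -((d : ℝ) / 2) + 1 = -(d / 2 - 1) by ring, div_neg, ← neg_div, neg_sub,
    show 1 - (d : ℝ) / 2 = -(d / 2 - 1) by ring, div_le_iff₀ (by linarith)]
  have h1 : 0 ≤ α ^ (-((d : ℝ) / 2 - 1)) := by positivity
  have h2 : 0 ≤ B ^ (-((d : ℝ) / 2 - 1)) := Real.rpow_nonneg (hα.le.trans hαB) _
  nlinarith

theorem dudleyBound_le_of_three_le {X : Type*} [MetricSpace X] [CompactSpace X] {d P : ℕ}
    (hd : 3 ≤ d) {K L B : ℝ} (hK : 0 < K) (hL : 0 < L) (hB : 0 < B) (a : X → Fin P)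
    (u : X → Fin d → ℝ) (hu : ∀ x i, 0 ≤ u x i ∧ u x i < 1)
    (hau : ∀ x y, a x = a y → dist x y ≤ K * dist (u x) (u y))
    {F : Set (X → ℝ)} (hF : F.Nonempty) (hFL : F ⊆ lipschitzClass X L B) {n : ℕ} (hn : 1 ≤ n)
    (h1 : 1 ≤ Real.log n) (h5B : 2 * Real.log (5 * B) ≤ Real.log n)
    (hBn : -(d : ℝ) * Real.log B ≤ Real.log n) :
    dudleyBound F B n ((n : ℝ) ^ (-(1 / (d : ℝ)))) ≤
      (4 + 24 * √(P * (2 * L * K + B) ^ d)) * (√(Real.log n) / (n : ℝ) ^ (1 / (d : ℝ))) := by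
  have hn' : (0 : ℝ) < n := by exact_mod_cast hn
  have hd' : (3 : ℝ) ≤ d := by exact_mod_cast hd
  set α := (n : ℝ) ^ (-(1 / (d : ℝ)))
  set S := √(P * (2 * L * K + B) ^ d)
  have hα : 0 < α := by positivity
  have hlogα : Real.log α = -(Real.log n / d) := by
    simp only [α]; rw [Real.log_rpow hn']; ring
  have hαB : α ≤ B := by
    rw [← Real.log_le_log_iff hα hB, hlogα, neg_le, le_div_iff₀ (by linarith)]
    linarith
  have hfin : ∀ ε : ℝ, 0 < ε → supCoveringNumber F ε ≠ ⊤ := fun ε hε =>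
    supCoveringNumber_lipschitz_ne_top hL hFL hε
  have hent : ∀ ε ∈ Icc α B, sqrtEntropy F ε ≤
      S * √(Real.log n) * ε ^ (-((d : ℝ) / 2)) := by
    intro ε hε
    have hε0 : 0 < ε := hα.trans_le hε.1
    have h2 := log_supCoveringNumber_le hK hL hB a u hu hau hF hFL hε0 hε.2
    have h3 : Real.log (5 * B / ε) ≤ Real.log n := by
      -- `log (5 B) + log n / d` is at most two halves of `log n`.
      have e1 : Real.log (5 * B / ε) ≤ Real.log (5 * B / α) :=
        Real.log_le_log (by positivity) (by gcongr; exact hε.1)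
      rw [Real.log_div (by positivity) hα.ne', hlogα] at e1
      have e2 : Real.log n / d ≤ Real.log n / 2 := by gcongr; linarith
      linarith
    have e3 : ε ^ (-((d : ℝ) / 2)) = √((ε ^ d)⁻¹) := by
      rw [Real.rpow_neg hε0.le, Real.sqrt_inv, Real.sqrt_eq_rpow, ← Real.rpow_natCast,
        ← Real.rpow_mul hε0.le]
      ring_nf
    rw [sqrtEntropy, e3, ← Real.sqrt_mul (by positivity), ← Real.sqrt_mul (by positivity)]
    refine Real.sqrt_le_sqrt (h2.trans ?_)
    calc _ ≤ P * ((2 * L * K + B) / ε) ^ d * Real.log n := by gcongr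
      _ = _ := by rw [div_pow]; ring
  have hint : ∫ ε in α..B, sqrtEntropy F ε ≤ S * √(Real.log n) * (2 * α ^ (1 - (d : ℝ) / 2)) := by
    have hI : IntervalIntegrable (fun ε : ℝ => ε ^ (-((d : ℝ) / 2))) volume α B :=
      intervalIntegral.intervalIntegrable_rpow
        (Or.inr (by rw [uIcc_of_le hαB]; exact fun h => h.1.not_gt hα))
    refine (intervalIntegral.integral_mono_on hαB (intervalIntegrable_sqrtEntropy hF hfin hα hB)
      (hI.const_mul _) hent).trans ?_
    rw [intervalIntegral.integral_const_mul]
    exact mul_le_mul_of_nonneg_left (integral_rpow_neg_half_le hd hα hαB) (by positivity)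
  -- The balance of scales: the `√n` here cancels the `1 / √n` before the integral, leaving order
  -- `α` up to `√(log n)`.
  have hpow : α ^ (1 - (d : ℝ) / 2) = √n * α := by
    simp only [α]
    rw [← Real.rpow_mul hn'.le, Real.sqrt_eq_rpow, ← Real.rpow_add hn']
    congr 1
    field_simp
    ring
  have hα' : α = 1 / (n : ℝ) ^ (1 / (d : ℝ)) := by
    simp only [α]; rw [Real.rpow_neg hn'.le, ← one_div]
  have hs : 0 < √(n : ℝ) := Real.sqrt_pos.2 hn'
  have hsl : 1 ≤ √(Real.log n) := Real.one_le_sqrt.2 h1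
  rw [div_eq_mul_one_div, ← hα', dudleyBound]
  calc 4 * α + 12 / √n * ∫ ε in α..B, sqrtEntropy F ε
      ≤ 4 * α + 12 / √n * (S * √(Real.log n) * (2 * (√n * α))) := by
        rw [← hpow]; gcongr
    _ = 4 * α * 1 + 24 * S * (√(Real.log n) * α) := by field_simp; ring
    _ ≤ 4 * α * √(Real.log n) + 24 * S * (√(Real.log n) * α) := by gcongr
    _ = _ := by ring

theorem empiricalRademacher_le_rate_planar {X : Type*} [MetricSpace X] {P : ℕ} {K L B : ℝ}
    (hK : 0 ≤ K) (hL : 0 ≤ L) (hB : 0 ≤ B) (a : X → Fin P) (u : X → Fin 2 → ℝ)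
    (hu : ∀ x i, 0 ≤ u x i ∧ u x i < 1)
    (hau : ∀ x y, a x = a y → dist x y ≤ K * dist (u x) (u y))
    {F : Set (X → ℝ)} (hF : F.Nonempty) (hFL : F ⊆ lipschitzClass X L B)
    {n : ℕ} (hn : 64 ≤ n) (h1 : 1 ≤ Real.log n) (x : Fin n → X) :
    empiricalRademacher F x ≤ (L * K + √(32 * P) * (L * K + B) * √8) *
      (√(Real.log n) / (n : ℝ) ^ (1 / ((2 : ℕ) : ℝ))) := by
  have hn' : (64 : ℝ) ≤ n := by exact_mod_cast hn
  have hs8 : 8 ≤ √(n : ℝ) := Real.le_sqrt_of_sq_le (by linarith)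
  have hs : 0 < √(n : ℝ) := by linarith
  have hN : 0 < ⌈√(n : ℝ)⌉₊ := Nat.ceil_pos.2 hs
  refine (empiricalRademacher_le_planar hK hL hB a u hu hau hF hFL (by omega) x hN).trans ?_
  set N := ⌈√(n : ℝ)⌉₊
  have hN1 : √(n : ℝ) ≤ N := Nat.le_ceil _
  have hN2 : (N : ℝ) ≤ 2 * √n := (Nat.ceil_lt_add_one hs.le).le.trans (by linarith)
  -- `4 N ≤ 8 √n ≤ n`, the last because `n ≥ 64`.
  have hlog : Real.log (4 * N : ℕ) ≤ Real.log n := by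
    refine Real.log_le_log (by push_cast; positivity) ?_
    push_cast
    nlinarith [Real.sq_sqrt (show (0 : ℝ) ≤ n by linarith)]
  have hsl : 1 ≤ √(Real.log n) := Real.one_le_sqrt.2 h1
  have e1 : L * K / N ≤ L * K * (√(Real.log n) / √n) := by
    calc L * K / N ≤ L * K / √n := by gcongr
      _ = L * K * (1 / √n) := by ring
      _ ≤ _ := by gcongr
  have e2 : √(4 * (1 + Real.log (4 * N : ℕ)) / n) ≤ √8 * (√(Real.log n) / √n) := by
    rw [← mul_div_assoc, ← Real.sqrt_mul (by norm_num), ← Real.sqrt_div (by positivity)]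
    refine Real.sqrt_le_sqrt (div_le_div_of_nonneg_right ?_ (by linarith))
    linarith
  rw [Nat.cast_ofNat, ← Real.sqrt_eq_rpow]
  calc _ ≤ L * K * (√(Real.log n) / √n) +
        √(32 * P) * (L * K + B) * (√8 * (√(Real.log n) / √n)) := by gcongr
    _ = _ := by ring

end Rate

end

theorem theorem3 (d : ℕ) (hd : 2 ≤ d) (M : Type*) [MetricSpace M] [CompactSpace M]
    [ChartedSpace (EuclideanSpace ℝ (Fin d)) M] [IsManifold (𝓡 d) ∞ M]
    [Bundle.RiemannianBundle (fun x : M => TangentSpace (𝓡 d) x)]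
    [IsContMDiffRiemannianBundle (𝓡 d) ∞ (EuclideanSpace ℝ (Fin d))
      (fun x : M => TangentSpace (𝓡 d) x)]
    [IsRiemannianManifold (𝓡 d) M] [MeasurableSpace M] [BorelSpace M]
    (L B : ℝ) (hL : 0 < L) (hB : 0 < B) :
    -- Dudley's entropy integral bound, with all its terms well defined
    (∀ (μ : Measure M) [IsProbabilityMeasure μ] (F : Set (M → ℝ)), F.Nonempty →
      F ⊆ lipschitzClass M L B → ∀ n : ℕ, 1 ≤ n →
        (∀ ε : ℝ, 0 < ε → supCoveringNumber F ε ≠ ⊤) ∧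
        (∀ α : ℝ, 0 < α → IntervalIntegrable (sqrtEntropy F) volume α B) ∧
        Integrable (fun x : Fin n → M => empiricalRademacher F x) (Measure.pi fun _ => μ) ∧
        rademacher μ n F ≤ ⨅ α : Set.Ioi (0 : ℝ), dudleyBound F B n α) ∧
    -- the rate, as `n → ∞`
    (∃ C > 0, ∃ n₀ : ℕ, ∀ κmin κmax : ℝ, SectionalCurvatureBounds d M κmin κmax →
      ∀ F : Set (M → ℝ), F.Nonempty → F ⊆ lipschitzClass M L B → ∀ n : ℕ, n₀ ≤ n →
        (∀ (μ : Measure M) [IsProbabilityMeasure μ],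
          rademacher μ n F ≤ C * curvatureRate d κmax L n) ∧
        (3 ≤ d → dudleyBound F B n ((n : ℝ) ^ (-(1 / (d : ℝ)))) ≤ C * curvatureRate d κmax L n)) := by
  have hfin : ∀ F : Set (M → ℝ), F ⊆ lipschitzClass M L B → ∀ ε : ℝ, 0 < ε →
      supCoveringNumber F ε ≠ ⊤ := fun F hFL ε hε => supCoveringNumber_lipschitz_ne_top hL hFL hε
  have hdudley : ∀ (μ : Measure M) [IsProbabilityMeasure μ] (F : Set (M → ℝ)), F.Nonempty →
      F ⊆ lipschitzClass M L B → ∀ n : ℕ, 1 ≤ n → ∀ α : ℝ, 0 < α →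
      rademacher μ n F ≤ dudleyBound F B n α := fun μ _ F hF hFL n hn α hα =>
    rademacher_le μ hL.le hF hFL hn fun x => empiricalRademacher_le_dudleyBound hF (hfin F hFL) hB
      (fun f hf => (hFL hf).2) hn x hα
  refine ⟨fun μ _ F hF hFL n hn => ⟨hfin F hFL,
    fun α hα => intervalIntegrable_sqrtEntropy hF (hfin F hFL) hα hB,
    integrable_empiricalRademacher μ hL.le hF hFL hn,
    have : Nonempty (Set.Ioi (0 : ℝ)) := ⟨⟨1, mem_Ioi.2 one_pos⟩⟩
    le_ciInf fun α => hdudley μ F hF hFL n hn α α.2⟩, ?_⟩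
  obtain ⟨P, K, a, u, hK, hu, hau⟩ := exists_piecewise_coordinates d M
  have hlog : Filter.Tendsto (fun n : ℕ => Real.log n) Filter.atTop Filter.atTop :=
    Real.tendsto_log_atTop.comp tendsto_natCast_atTop_atTop
  obtain ⟨n₀, hn₀⟩ := Filter.eventually_atTop.1 ((Filter.eventually_ge_atTop 64).and
    ((hlog.eventually_ge_atTop 1).and ((hlog.eventually_ge_atTop (-4 * Real.log L)).and
      ((hlog.eventually_ge_atTop (2 * Real.log (5 * B))).and
        (hlog.eventually_ge_atTop (-(d : ℝ) * Real.log B))))))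
  -- Dimension two uses the planar flow; from dimension three on, the Dudley bound at `α = n^{-1/d}`
  -- suffices.
  rcases hd.eq_or_lt with rfl | hd3
  · set S := L * K + √(32 * P) * (L * K + B) * √8
    have hS : 0 < S := by positivity
    refine ⟨S * 2, by positivity, n₀, fun _ κmax _ F hF hFL n hn =>
      ⟨fun μ _ => ?_, fun h => absurd h (by norm_num)⟩⟩
    obtain ⟨h64, h1, hLn, -, -⟩ := hn₀ n hn
    refine rademacher_le μ hL.le hF hFL (by omega) fun x =>
      (empiricalRademacher_le_rate_planar hK.le hL.le hB.le a u hu hau hF hFL h64 h1 x).trans ?_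
    rw [mul_assoc S]
    exact mul_le_mul_of_nonneg_left
      (sqrt_log_div_le_curvatureRate (by norm_num) κmax hL (by omega) hLn) hS.le
  · set S := 4 + 24 * √(P * (2 * L * K + B) ^ d)
    have hS : 0 < S := by positivity
    refine ⟨S * 2, by positivity, n₀, fun _ κmax _ F hF hFL n hn => ?_⟩
    obtain ⟨h64, h1, hLn, h5B, hBn⟩ := hn₀ n hn
    have key : dudleyBound F B n ((n : ℝ) ^ (-(1 / (d : ℝ)))) ≤
        S * 2 * curvatureRate d κmax L n := by
      refine (dudleyBound_le_of_three_le hd3 hK hL hB a u hu hau hF hFL (by omega) h1 h5B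
        hBn).trans ?_
      rw [mul_assoc S]
      exact mul_le_mul_of_nonneg_left
        (sqrt_log_div_le_curvatureRate (by omega) κmax hL (by omega) hLn) hS.le
    have hn' : (0 : ℝ) < n := by exact_mod_cast (show 0 < n by omega)
    exact ⟨fun μ _ => (hdudley μ F hF hFL n (by omega) _ (by positivity)).trans key, fun _ => key⟩
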